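/- Let $\mathbb K$ be a field of characteristic zero. A \emph{shuffle operad} is a monoid for the shuffle composition in the category of collections, i.e. of families $(V(k))_{k\ge 1}$ of $\mathbb K$-vector spaces. A \emph{shuffle $\omega$-operad} is a strict $\omega$-category internal to shuffle operads; its shuffle operad of $n$-cells is denoted $P_n$. A \emph{shuffle $\omega$-polygraph} is a sequence $X=(X_0,X_1,\dots)$, where $X_0$ is a family of sets indexed by the arities $k\ge 1$ and, for every $n\ge 0$, $X_{n+1}$ is a cellular extension of the free shuffle $n$-operad on $(X_0,\dots,X_n)$, i.e. an indexed set whose elements have a source and a target among the $n$-cells of that $n$-operad, of the same arity and subject to the globular relations; $X^*$ denotes the free shuffle $\omega$-operad on $X$. The shuffle operad $\overline X$ \emph{presented} by $X$ is the coequalizer of $s,t:X^*_1\rightrightarrows X^*_0$ in the category of shuffle operads. The polygraph $X$ is \emph{acyclic} if, for every $n\ge 1$ and all parallel $n$-cells $f,g$ of $X^*$ (i.e. $n$-cells with the same source and the same target), there is an $(n+1)$-cell $f\to g$ in $X^*$. For $n$-cells $a,b$ of a shuffle $\omega$-operad, write $a\sim_\omega b$ if there is an $(n+1)$-cell $a\to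 b$. A morphism $F:P\to Q$ of shuffle $\omega$-operads is a \emph{weak equivalence} if (i) for every $0$-cell $a$ of $Q$ there is a $0$-cell $\hat a$ of $P$ with $F(\hat a)\sim_\omega a$; (ii) for all $0$-cells $a,b$ of $P$ of the same arity and every $1$-cell $f:F(a)\to F(b)$ of $Q$ there is a $1$-cell $\hat f:a\to b$ of $P$ with $F(\hat f)\sim_\omega f$; (iii) for all $n\ge 1$, all parallel $n$-cells $a,b$ of $P$ and every $(n+1)$-cell $f:F(a)\to F(b)$ of $Q$ there is an $(n+1)$-cell $\hat f:a\to b$ of $P$ with $F(\hat f)\sim_\omega f$. Shuffle $\omega$-polygraphs $X$ and $Y$ are \emph{Tietze equivalent} if there is a weak equivalence $X^*\to Y^*$. Proposition. Let $X$ and $Y$ be acyclic shuffle $\omega$-polygraphs. Then the presented shuffle operads $\overline X$ and $\overline Y$ are isomorphic if and only if $X$ and $Y$ are Tietze equivalent. -/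

import Mathlib

universe u v w

namespace ShuffleOp

/-! ## Shuffle operads -/

/-- A shuffle surjection `f : [n] ↠ [k]` of type `(m 0, …, m (k-1))`, all `m i ≥ 1`: the fibre over
`i` has `m i` elements, and the minima of the fibres increase with `i`. The map `emb i` is the
increasing enumeration of the fibre over `i` (it is determined by `toFun`); `emb i 0` is the minimum
of that fibre. -/
structure ShuffleSurj {k : ℕ+} (m : Fin k → ℕ+) (n : ℕ+) where
  toFun : Fin n → Fin k
  emb : ∀ i : Fin k, Fin (m i) ↪o Fin n
  range_emb : ∀ i, Set.range (emb i) = toFun ⁻¹' {i}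
  min_lt : ∀ i j, i < j → emb i ⟨0, (m i).pos⟩ < emb j ⟨0, (m j).pos⟩

/-- A shuffle operad over `K`: a collection `(obj k)_{k ≥ 1}` of vector spaces with the structure
of a monoid for the shuffle composition. A morphism `P ∘ P ⟶ P` of collections is a family of
multilinear maps `P(k) × P(m 0) × ⋯ × P(m (k-1)) → P(n)`, one for each shuffle surjection
`f : [n] ↠ [k]` of type `m`; a morphism `𝕀 ⟶ P` is an element of `P(1)`. -/
structure ShuffleOperad (K : Type u) [Field K] where
  obj : ℕ+ → Type v
  [addCommGroup : ∀ k, AddCommGroup (obj k)]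
  [module : ∀ k, Module K (obj k)]
  unit : obj 1
  comp : ∀ {k n : ℕ+} {m : Fin k → ℕ+}, ShuffleSurj m n → obj k → (∀ i, obj (m i)) → obj n
  comp_add_left : ∀ {k n : ℕ+} {m : Fin k → ℕ+} (f : ShuffleSurj m n) (x x' : obj k)
    (y : ∀ i, obj (m i)), comp f (x + x') y = comp f x y + comp f x' y
  comp_smul_left : ∀ {k n : ℕ+} {m : Fin k → ℕ+} (f : ShuffleSurj m n) (r : K) (x : obj k)
    (y : ∀ i, obj (m i)), comp f (r • x) y = r • comp f x y
  comp_add_right : ∀ {k n : ℕ+} {m : Fin k → ℕ+} (f : ShuffleSurj m n) (x : obj k)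
    (y : ∀ i, obj (m i)) (i : Fin k) (a b : obj (m i)),
    comp f x (Function.update y i (a + b)) =
      comp f x (Function.update y i a) + comp f x (Function.update y i b)
  comp_smul_right : ∀ {k n : ℕ+} {m : Fin k → ℕ+} (f : ShuffleSurj m n) (x : obj k)
    (y : ∀ i, obj (m i)) (i : Fin k) (r : K) (a : obj (m i)),
    comp f x (Function.update y i (r • a)) = r • comp f x (Function.update y i a)
  /-- left unit law (there is exactly one surjection onto a one-point set) -/
  unit_comp : ∀ {n : ℕ+} (f : ShuffleSurj (k := 1) (fun _ => n) n) (x : obj n),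
    comp f unit (fun _ => x) = x
  /-- right unit law (the identity is the only shuffle surjection of type `(1, …, 1)`) -/
  comp_unit : ∀ {n : ℕ+} (f : ShuffleSurj (k := n) (fun _ => 1) n) (x : obj n),
    comp f x (fun _ => unit) = x
  /-- associativity: `((x ∣_f y) ∣_g z) = (x ∣_{fg} (y ∣_{f,g} z))`. Here `e` is the composite
  surjection `[N] ↠ [n] ↠ [k]` and `h i` is the restriction of `g` to the preimage of the fibre of
  `f` over `i`, both re-indexed by the increasing enumerations of the fibres. The data `e`, `h` are
  determined by `f`, `g`. -/
  comp_assoc : ∀ {k n N : ℕ+} {m p : Fin k → ℕ+} {l : Fin n → ℕ+}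
    (f : ShuffleSurj m n) (g : ShuffleSurj l N)
    (h : ∀ i, ShuffleSurj (fun j : Fin (m i) => l (f.emb i j)) (p i)) (e : ShuffleSurj p N),
    (∀ i j a, e.emb i ((h i).emb j a) = g.emb (f.emb i j) a) →
    ∀ (x : obj k) (y : ∀ i, obj (m i)) (z : ∀ j, obj (l j)),
    comp g (comp f x y) z = comp e x (fun i => comp (h i) (y i) (fun j => z (f.emb i j)))

attribute [instance] ShuffleOperad.addCommGroup ShuffleOperad.module

/-- Morphisms of shuffle operads. -/
structure ShuffleOperad.Hom {K : Type u} [Field K] (P : ShuffleOperad.{u, v} K)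
    (Q : ShuffleOperad.{u, w} K) where
  toFun : ∀ k, P.obj k →ₗ[K] Q.obj k
  map_unit : toFun 1 P.unit = Q.unit
  map_comp : ∀ {k n : ℕ+} {m : Fin k → ℕ+} (f : ShuffleSurj m n) (x : P.obj k)
    (y : ∀ i, P.obj (m i)),
    toFun n (P.comp f x y) = Q.comp f (toFun k x) (fun i => toFun (m i) (y i))

/-- Two shuffle operads are isomorphic: there are mutually inverse morphisms between them. -/
def ShuffleOperad.Isomorphic {K : Type u} [Field K] (P : ShuffleOperad.{u, v} K)
    (Q : ShuffleOperad.{u, w} K) : Prop :=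
  ∃ (F : ShuffleOperad.Hom P Q) (G : ShuffleOperad.Hom Q P),
    (∀ k x, G.toFun k (F.toFun k x) = x) ∧ (∀ k y, F.toFun k (G.toFun k y) = y)

/-! ## Quotients of operads

Operations and an equivalence relation compatible with them, such that the axioms of shuffle operads
hold up to that relation; the quotient is a shuffle operad. -/

structure OperadUpTo (K : Type u) [Field K] where
  obj : ℕ+ → Type v
  rel : ∀ {k}, obj k → obj k → Prop
  refl : ∀ {k} (a : obj k), rel a a
  symm : ∀ {k} {a b : obj k}, rel a b → rel b a
  trans : ∀ {k} {a b c : obj k}, rel a b → rel b c → rel a c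
  zero : ∀ k, obj k
  add : ∀ {k}, obj k → obj k → obj k
  smul : ∀ {k}, K → obj k → obj k
  unit : obj 1
  comp : ∀ {k n : ℕ+} {m : Fin k → ℕ+}, ShuffleSurj m n → obj k → (∀ i, obj (m i)) → obj n
  add_congr : ∀ {k} {a a' b b' : obj k}, rel a a' → rel b b' → rel (add a b) (add a' b')
  smul_congr : ∀ {k} (r : K) {a a' : obj k}, rel a a' → rel (smul r a) (smul r a')
  comp_congr : ∀ {k n : ℕ+} {m : Fin k → ℕ+} (f : ShuffleSurj m n) {x x' : obj k}
    {y y' : ∀ i, obj (m i)}, rel x x' → (∀ i, rel (y i) (y' i)) → rel (comp f x y) (comp f x' y')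
  add_assoc : ∀ {k} (a b c : obj k), rel (add (add a b) c) (add a (add b c))
  add_comm : ∀ {k} (a b : obj k), rel (add a b) (add b a)
  add_zero : ∀ {k} (a : obj k), rel (add a (zero k)) a
  add_neg : ∀ {k} (a : obj k), rel (add a (smul (-1) a)) (zero k)
  smul_add : ∀ {k} (r : K) (a b : obj k), rel (smul r (add a b)) (add (smul r a) (smul r b))
  add_smul : ∀ {k} (r s : K) (a : obj k), rel (smul (r + s) a) (add (smul r a) (smul s a))
  mul_smul : ∀ {k} (r s : K) (a : obj k), rel (smul (r * s) a) (smul r (smul s a))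
  one_smul : ∀ {k} (a : obj k), rel (smul 1 a) a
  comp_add_left : ∀ {k n : ℕ+} {m : Fin k → ℕ+} (f : ShuffleSurj m n) (x x' : obj k)
    (y : ∀ i, obj (m i)), rel (comp f (add x x') y) (add (comp f x y) (comp f x' y))
  comp_smul_left : ∀ {k n : ℕ+} {m : Fin k → ℕ+} (f : ShuffleSurj m n) (r : K) (x : obj k)
    (y : ∀ i, obj (m i)), rel (comp f (smul r x) y) (smul r (comp f x y))
  comp_add_right : ∀ {k n : ℕ+} {m : Fin k → ℕ+} (f : ShuffleSurj m n) (x : obj k)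
    (y : ∀ i, obj (m i)) (i : Fin k) (a b : obj (m i)),
    rel (comp f x (Function.update y i (add a b)))
      (add (comp f x (Function.update y i a)) (comp f x (Function.update y i b)))
  comp_smul_right : ∀ {k n : ℕ+} {m : Fin k → ℕ+} (f : ShuffleSurj m n) (x : obj k)
    (y : ∀ i, obj (m i)) (i : Fin k) (r : K) (a : obj (m i)),
    rel (comp f x (Function.update y i (smul r a))) (smul r (comp f x (Function.update y i a)))
  unit_comp : ∀ {n : ℕ+} (f : ShuffleSurj (k := 1) (fun _ => n) n) (x : obj n),
    rel (comp f unit (fun _ => x)) x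
  comp_unit : ∀ {n : ℕ+} (f : ShuffleSurj (k := n) (fun _ => 1) n) (x : obj n),
    rel (comp f x (fun _ => unit)) x
  comp_assoc : ∀ {k n N : ℕ+} {m p : Fin k → ℕ+} {l : Fin n → ℕ+}
    (f : ShuffleSurj m n) (g : ShuffleSurj l N)
    (h : ∀ i, ShuffleSurj (fun j : Fin (m i) => l (f.emb i j)) (p i)) (e : ShuffleSurj p N),
    (∀ i j a, e.emb i ((h i).emb j a) = g.emb (f.emb i j) a) →
    ∀ (x : obj k) (y : ∀ i, obj (m i)) (z : ∀ j, obj (l j)),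
    rel (comp g (comp f x y) z)
      (comp e x (fun i => comp (h i) (y i) (fun j => z (f.emb i j))))

namespace OperadUpTo

variable {K : Type u} [Field K] (P : OperadUpTo.{u, v} K)

/-- The equivalence relation as a setoid. -/
def setoid (k : ℕ+) : Setoid (P.obj k) where
  r := P.rel
  iseqv := ⟨P.refl, P.symm, P.trans⟩

/-- The quotient in arity `k`. -/
def Quo (k : ℕ+) : Type v := Quotient (P.setoid k)

/-- The class of an element. -/
def cls {k : ℕ+} (a : P.obj k) : P.Quo k := Quotient.mk (P.setoid k) a

theorem cls_eq {k : ℕ+} {a b : P.obj k} : P.cls a = P.cls b ↔ P.rel a b :=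
  ⟨fun h => Quotient.exact h, fun h => Quotient.sound (s := P.setoid k) h⟩

theorem ind {k : ℕ+} {C : P.Quo k → Prop} (h : ∀ a, C (P.cls a)) (q : P.Quo k) : C q :=
  Quotient.ind h q

theorem cls_out {k : ℕ+} (q : P.Quo k) : P.cls (Quotient.out q) = q := Quotient.out_eq q

theorem ind_pi {k : ℕ+} {m : Fin k → ℕ+} {C : (∀ i, P.Quo (m i)) → Prop}
    (h : ∀ a : ∀ i, P.obj (m i), C (fun i => P.cls (a i))) (q : ∀ i, P.Quo (m i)) : C q := by
  have := h (fun i => Quotient.out (q i))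
  simpa only [P.cls_out] using this

instance instZero (k : ℕ+) : Zero (P.Quo k) := ⟨P.cls (P.zero k)⟩

instance instAdd (k : ℕ+) : Add (P.Quo k) :=
  ⟨Quotient.map₂ P.add (fun _ _ h _ _ h' => P.add_congr h h')⟩

instance instSMul (k : ℕ+) : SMul K (P.Quo k) :=
  ⟨fun r => Quotient.map (P.smul r) (fun _ _ h => P.smul_congr r h)⟩

instance instNeg (k : ℕ+) : Neg (P.Quo k) := ⟨fun a => (-1 : K) • a⟩

theorem cls_zero (k : ℕ+) : P.cls (P.zero k) = 0 := rfl

theorem cls_add {k : ℕ+} (a b : P.obj k) : P.cls (P.add a b) = P.cls a + P.cls b := rfl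

theorem cls_smul {k : ℕ+} (r : K) (a : P.obj k) : P.cls (P.smul r a) = r • P.cls a := rfl

instance instAddCommGroup (k : ℕ+) : AddCommGroup (P.Quo k) where
  add_assoc a b c := by
    induction a using P.ind; induction b using P.ind; induction c using P.ind
    simp only [← cls_add]; exact P.cls_eq.2 (P.add_assoc _ _ _)
  zero_add a := by
    induction a using P.ind
    simp only [← cls_add, ← cls_zero]
    exact P.cls_eq.2 (P.trans (P.add_comm _ _) (P.add_zero _))
  add_zero a := by
    induction a using P.ind
    simp only [← cls_add, ← cls_zero]; exact P.cls_eq.2 (P.add_zero _)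
  add_comm a b := by
    induction a using P.ind; induction b using P.ind
    simp only [← cls_add]; exact P.cls_eq.2 (P.add_comm _ _)
  neg_add_cancel a := by
    induction a using P.ind
    change (-1 : K) • _ + _ = _
    simp only [← cls_add, ← cls_zero, ← cls_smul]
    exact P.cls_eq.2 (P.trans (P.add_comm _ _) (P.add_neg _))
  nsmul := nsmulRec
  zsmul := zsmulRec

instance instModule (k : ℕ+) : Module K (P.Quo k) :=
  Module.ofMinimalAxioms
    (fun r a b => by
      induction a using P.ind; induction b using P.ind
      simp only [← cls_add, ← cls_smul]; exact P.cls_eq.2 (P.smul_add _ _ _))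
    (fun r s a => by
      induction a using P.ind
      simp only [← cls_add, ← cls_smul]; exact P.cls_eq.2 (P.add_smul _ _ _))
    (fun r s a => by
      induction a using P.ind
      simp only [← cls_smul]; exact P.cls_eq.2 (P.mul_smul _ _ _))
    (fun a => by
      induction a using P.ind
      simp only [← cls_smul]; exact P.cls_eq.2 (P.one_smul _))

/-- Composition in the quotient, through representatives. -/
noncomputable def compQ {k n : ℕ+} {m : Fin k → ℕ+} (f : ShuffleSurj m n) (x : P.Quo k)
    (y : ∀ i, P.Quo (m i)) : P.Quo n :=
  P.cls (P.comp f (Quotient.out x) (fun i => Quotient.out (y i)))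

theorem cls_comp {k n : ℕ+} {m : Fin k → ℕ+} (f : ShuffleSurj m n) (x : P.obj k)
    (y : ∀ i, P.obj (m i)) :
    P.cls (P.comp f x y) = P.compQ f (P.cls x) (fun i => P.cls (y i)) :=
  P.cls_eq.2 (P.comp_congr f (P.cls_eq.1 (P.cls_out _).symm)
    (fun _ => P.cls_eq.1 (P.cls_out _).symm))

theorem cls_update {k : ℕ+} {m : Fin k → ℕ+} (y : ∀ i, P.obj (m i)) (i : Fin k) (a : P.obj (m i)) :
    Function.update (fun i => P.cls (y i)) i (P.cls a) =
      fun j => P.cls (Function.update y i a j) := by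
  funext j
  by_cases h : j = i
  · subst h; simp
  · simp [Function.update_of_ne h]

/-- The quotient shuffle operad. -/
noncomputable def quotient : ShuffleOperad.{u, v} K where
  obj := P.Quo
  unit := P.cls P.unit
  comp := P.compQ
  comp_add_left f x x' y := by
    induction x using P.ind; induction x' using P.ind; induction y using P.ind_pi
    simp only [← cls_add, ← cls_comp]; exact P.cls_eq.2 (P.comp_add_left _ _ _ _)
  comp_smul_left f r x y := by
    induction x using P.ind; induction y using P.ind_pi
    simp only [← cls_smul, ← cls_comp]; exact P.cls_eq.2 (P.comp_smul_left _ _ _ _)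
  comp_add_right f x y i a b := by
    induction x using P.ind; induction y using P.ind_pi
    induction a using P.ind; induction b using P.ind
    simp only [← cls_add, ← cls_comp, cls_update]; exact P.cls_eq.2 (P.comp_add_right _ _ _ _ _ _)
  comp_smul_right f x y i r a := by
    induction x using P.ind; induction y using P.ind_pi; induction a using P.ind
    simp only [← cls_smul, ← cls_comp, cls_update]; exact P.cls_eq.2 (P.comp_smul_right _ _ _ _ _ _)
  unit_comp f x := by
    induction x using P.ind
    rw [← cls_comp]; exact P.cls_eq.2 (P.unit_comp _ _)
  comp_unit f x := by
    induction x using P.ind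
    rw [← cls_comp]; exact P.cls_eq.2 (P.comp_unit _ _)
  comp_assoc f g h e he x y z := by
    induction x using P.ind; induction y using P.ind_pi; induction z using P.ind_pi
    simp only [← cls_comp]; exact P.cls_eq.2 (P.comp_assoc f g h e he _ _ _)

end OperadUpTo

/-! ## Coequalizers of shuffle operads -/

/-- The smallest congruence on the shuffle operad `Q` (equivalence relation compatible with linear
combinations and composition) that identifies `F a` with `G a` for all `a`. -/
inductive CoeqRel {K : Type u} [Field K] {P : ShuffleOperad.{u, v} K} {Q : ShuffleOperad.{u, w} K}
    (F G : ShuffleOperad.Hom P Q) : ∀ {k : ℕ+}, Q.obj k → Q.obj k → Prop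
  | of {k : ℕ+} (a : P.obj k) : CoeqRel F G (F.toFun k a) (G.toFun k a)
  | refl {k : ℕ+} (a : Q.obj k) : CoeqRel F G a a
  | symm {k : ℕ+} {a b : Q.obj k} : CoeqRel F G a b → CoeqRel F G b a
  | trans {k : ℕ+} {a b c : Q.obj k} : CoeqRel F G a b → CoeqRel F G b c → CoeqRel F G a c
  | add {k : ℕ+} {a a' b b' : Q.obj k} :
      CoeqRel F G a a' → CoeqRel F G b b' → CoeqRel F G (a + b) (a' + b')
  | smul {k : ℕ+} (r : K) {a a' : Q.obj k} : CoeqRel F G a a' → CoeqRel F G (r • a) (r • a')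
  | comp {k n : ℕ+} {m : Fin k → ℕ+} (f : ShuffleSurj m n) {x x' : Q.obj k}
      {y y' : ∀ i, Q.obj (m i)} : CoeqRel F G x x' → (∀ i, CoeqRel F G (y i) (y' i)) →
      CoeqRel F G (Q.comp f x y) (Q.comp f x' y')

theorem CoeqRel.of_eq {K : Type u} [Field K] {P : ShuffleOperad.{u, v} K}
    {Q : ShuffleOperad.{u, w} K} {F G : ShuffleOperad.Hom P Q} {k : ℕ+} {a b : Q.obj k}
    (h : a = b) : CoeqRel F G a b := h ▸ CoeqRel.refl a

/-- The coequalizer of two parallel morphisms of shuffle operads. -/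
noncomputable def coequalizer {K : Type u} [Field K] {P : ShuffleOperad.{u, v} K}
    {Q : ShuffleOperad.{u, w} K} (F G : ShuffleOperad.Hom P Q) : ShuffleOperad.{u, w} K :=
  OperadUpTo.quotient
    { obj := Q.obj
      rel := CoeqRel F G
      refl := CoeqRel.refl
      symm := CoeqRel.symm
      trans := CoeqRel.trans
      zero := fun _ => 0
      add := fun a b => a + b
      smul := fun r a => r • a
      unit := Q.unit
      comp := Q.comp
      add_congr := CoeqRel.add
      smul_congr := CoeqRel.smul
      comp_congr := CoeqRel.comp
      add_assoc := fun _ _ _ => .of_eq (add_assoc _ _ _)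
      add_comm := fun _ _ => .of_eq (add_comm _ _)
      add_zero := fun _ => .of_eq (add_zero _)
      add_neg := fun _ => .of_eq (by simp)
      smul_add := fun _ _ _ => .of_eq (smul_add _ _ _)
      add_smul := fun _ _ _ => .of_eq (add_smul _ _ _)
      mul_smul := fun _ _ _ => .of_eq (mul_smul _ _ _)
      one_smul := fun _ => .of_eq (one_smul _ _)
      comp_add_left := fun _ _ _ _ => .of_eq (Q.comp_add_left _ _ _ _)
      comp_smul_left := fun _ _ _ _ => .of_eq (Q.comp_smul_left _ _ _ _)
      comp_add_right := fun _ _ _ _ _ _ => .of_eq (Q.comp_add_right _ _ _ _ _ _)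
      comp_smul_right := fun _ _ _ _ _ _ => .of_eq (Q.comp_smul_right _ _ _ _ _ _)
      unit_comp := fun _ _ => .of_eq (Q.unit_comp _ _)
      comp_unit := fun _ _ => .of_eq (Q.comp_unit _ _)
      comp_assoc := fun f g h e he _ _ _ => .of_eq (Q.comp_assoc f g h e he _ _ _) }

/-! ## Iterated sources, targets and identities -/

/-- Iterate maps `A (n+1) → A n` from dimension `l` down to dimension `k ≤ l`. -/
def descend {A : ℕ → Type v} (d : ∀ n, A (n + 1) → A n) {k l : ℕ} (h : k ≤ l) : A l → A k :=
  Nat.leRec (motive := fun l _ => A l → A k) (fun a => a) (fun l _ ih a => ih (d l a)) h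

/-- Iterate maps `A n → A (n+1)` from dimension `k` up to dimension `l ≥ k`. -/
def ascend {A : ℕ → Type v} (e : ∀ n, A n → A (n + 1)) {k l : ℕ} (h : k ≤ l) : A k → A l :=
  Nat.leRec (motive := fun l _ => A k → A l) (fun a => a) (fun l _ ih a => e l (ih a)) h

theorem descend_self {A : ℕ → Type v} (d : ∀ n, A (n + 1) → A n) {k : ℕ} (h : k ≤ k) (a : A k) :
    descend d h a = a := by
  unfold descend; rw [Nat.leRec_self]

theorem descend_succ {A : ℕ → Type v} (d : ∀ n, A (n + 1) → A n) {k l : ℕ} (h : k ≤ l)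
    (h' : k ≤ l + 1) (a : A (l + 1)) : descend d h' a = descend d h (d l a) := by
  unfold descend; rw [Nat.leRec_succ _ _ h]

theorem ascend_self {A : ℕ → Type v} (e : ∀ n, A n → A (n + 1)) {k : ℕ} (h : k ≤ k) (a : A k) :
    ascend e h a = a := by
  unfold ascend; rw [Nat.leRec_self]

theorem ascend_succ {A : ℕ → Type v} (e : ∀ n, A n → A (n + 1)) {k l : ℕ} (h : k ≤ l)
    (h' : k ≤ l + 1) (a : A k) : ascend e h' a = e l (ascend e h a) := by
  unfold ascend; rw [Nat.leRec_succ _ _ h]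

/-! ## Shuffle ω-operads -/

/-- A reflexive globular object in shuffle operads. -/
structure GlobOperad (K : Type u) [Field K] where
  cell : ℕ → ShuffleOperad.{u, v} K
  src : ∀ n, ShuffleOperad.Hom (cell (n + 1)) (cell n)
  tgt : ∀ n, ShuffleOperad.Hom (cell (n + 1)) (cell n)
  idn : ∀ n, ShuffleOperad.Hom (cell n) (cell (n + 1))
  src_src : ∀ n p (a : (cell (n + 2)).obj p),
    (src n).toFun p ((src (n + 1)).toFun p a) = (src n).toFun p ((tgt (n + 1)).toFun p a)
  tgt_tgt : ∀ n p (a : (cell (n + 2)).obj p),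
    (tgt n).toFun p ((tgt (n + 1)).toFun p a) = (tgt n).toFun p ((src (n + 1)).toFun p a)
  src_idn : ∀ n p (a : (cell n).obj p), (src n).toFun p ((idn n).toFun p a) = a
  tgt_idn : ∀ n p (a : (cell n).obj p), (tgt n).toFun p ((idn n).toFun p a) = a

namespace GlobOperad

variable {K : Type u} [Field K] (P : GlobOperad.{u, v} K)

/-- The `l`-cells of arity `p`. -/
abbrev C (l : ℕ) (p : ℕ+) : Type v := (P.cell l).obj p

/-- The `k`-source of an `l`-cell, `k ≤ l`. -/
def srcTo {k l : ℕ} (h : k ≤ l) {p : ℕ+} : P.C l p → P.C k p :=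
  descend (A := fun n => P.C n p) (fun n => (P.src n).toFun p) h

/-- The `k`-target of an `l`-cell, `k ≤ l`. -/
def tgtTo {k l : ℕ} (h : k ≤ l) {p : ℕ+} : P.C l p → P.C k p :=
  descend (A := fun n => P.C n p) (fun n => (P.tgt n).toFun p) h

/-- The iterated identity `l`-cell on a `k`-cell, `k ≤ l`. -/
def idTo {k l : ℕ} (h : k ≤ l) {p : ℕ+} : P.C k p → P.C l p :=
  ascend (A := fun n => P.C n p) (fun n => (P.idn n).toFun p) h

end GlobOperad

/-- A shuffle `ω`-operad: a strict `ω`-category internal to shuffle operads. -/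
structure OmegaOperad (K : Type u) [Field K] extends GlobOperad.{u, v} K where
  /-- The composite `a ⋆_k b` of `l`-cells with `t_k a = s_k b`. -/
  star : ∀ {k l : ℕ} (h : k < l) {p : ℕ+} (a b : toGlobOperad.C l p),
    toGlobOperad.tgtTo h.le a = toGlobOperad.srcTo h.le b → toGlobOperad.C l p
  -- `⋆_k` is a morphism of shuffle operads on the pullback of `t_k` and `s_k`
  star_add : ∀ {k l : ℕ} (h : k < l) {p : ℕ+} (a b a' b' : toGlobOperad.C l p) (h₁ h₂ h₃),
    star h (a + a') (b + b') h₃ = star h a b h₁ + star h a' b' h₂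
  star_smul : ∀ {k l : ℕ} (h : k < l) {p : ℕ+} (r : K) (a b : toGlobOperad.C l p) (h₁ h₂),
    star h (r • a) (r • b) h₂ = r • star h a b h₁
  star_unit : ∀ {k l : ℕ} (h : k < l) (h₁),
    star h (cell l).unit (cell l).unit h₁ = (cell l).unit
  star_comp : ∀ {k l : ℕ} (h : k < l) {q n : ℕ+} {m : Fin q → ℕ+} (f : ShuffleSurj m n)
    (x x' : toGlobOperad.C l q) (y y' : ∀ i, toGlobOperad.C l (m i)) (h₁)
    (h₂ : ∀ i, toGlobOperad.tgtTo h.le (y i) = toGlobOperad.srcTo h.le (y' i)) (h₃),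
    (cell l).comp f (star h x x' h₁) (fun i => star h (y i) (y' i) (h₂ i)) =
      star h ((cell l).comp f x y) ((cell l).comp f x' y') h₃
  -- `A_k ⇇ A_l` is a category
  src_star : ∀ {k l : ℕ} (h : k < l) {p : ℕ+} (a b : toGlobOperad.C l p) (h₁),
    toGlobOperad.srcTo h.le (star h a b h₁) = toGlobOperad.srcTo h.le a
  tgt_star : ∀ {k l : ℕ} (h : k < l) {p : ℕ+} (a b : toGlobOperad.C l p) (h₁),
    toGlobOperad.tgtTo h.le (star h a b h₁) = toGlobOperad.tgtTo h.le b
  star_assoc : ∀ {k l : ℕ} (h : k < l) {p : ℕ+} (a b c : toGlobOperad.C l p) (h₁ h₂ h₃ h₄),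
    star h (star h a b h₁) c h₂ = star h a (star h b c h₃) h₄
  id_star : ∀ {k l : ℕ} (h : k < l) {p : ℕ+} (a : toGlobOperad.C l p) (h₁),
    star h (toGlobOperad.idTo h.le (toGlobOperad.srcTo h.le a)) a h₁ = a
  star_id : ∀ {k l : ℕ} (h : k < l) {p : ℕ+} (a : toGlobOperad.C l p) (h₁),
    star h a (toGlobOperad.idTo h.le (toGlobOperad.tgtTo h.le a)) h₁ = a
  -- `A_j ⇇ A_k ⇇ A_l` is a 2-category
  srcTo_star : ∀ {j k l : ℕ} (hj : j < k) (hk : k < l) {p : ℕ+} (a b : toGlobOperad.C l p) (h₁ h₂),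
    toGlobOperad.srcTo hk.le (star (hj.trans hk) a b h₁) =
      star hj (toGlobOperad.srcTo hk.le a) (toGlobOperad.srcTo hk.le b) h₂
  tgtTo_star : ∀ {j k l : ℕ} (hj : j < k) (hk : k < l) {p : ℕ+} (a b : toGlobOperad.C l p) (h₁ h₂),
    toGlobOperad.tgtTo hk.le (star (hj.trans hk) a b h₁) =
      star hj (toGlobOperad.tgtTo hk.le a) (toGlobOperad.tgtTo hk.le b) h₂
  idTo_star : ∀ {j k l : ℕ} (hj : j < k) (hk : k < l) {p : ℕ+} (a b : toGlobOperad.C k p) (h₁ h₂),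
    toGlobOperad.idTo hk.le (star hj a b h₁) =
      star (hj.trans hk) (toGlobOperad.idTo hk.le a) (toGlobOperad.idTo hk.le b) h₂
  star_exchange : ∀ {j k l : ℕ} (hj : j < k) (hk : k < l) {p : ℕ+}
    (a a' b b' : toGlobOperad.C l p) (h₁ h₂ h₃ h₄ h₅ h₆),
    star (hj.trans hk) (star hk a a' h₁) (star hk b b' h₂) h₃ =
      star hk (star (hj.trans hk) a b h₄) (star (hj.trans hk) a' b' h₅) h₆

/-- Morphisms of shuffle `ω`-operads (internal `ω`-functors). -/
structure OmegaOperad.Hom {K : Type u} [Field K] (P : OmegaOperad.{u, v} K)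
    (Q : OmegaOperad.{u, w} K) where
  toHom : ∀ n, ShuffleOperad.Hom (P.cell n) (Q.cell n)
  map_src : ∀ n p (a : P.C (n + 1) p),
    (toHom n).toFun p ((P.src n).toFun p a) = (Q.src n).toFun p ((toHom (n + 1)).toFun p a)
  map_tgt : ∀ n p (a : P.C (n + 1) p),
    (toHom n).toFun p ((P.tgt n).toFun p a) = (Q.tgt n).toFun p ((toHom (n + 1)).toFun p a)
  map_idn : ∀ n p (a : P.C n p),
    (toHom (n + 1)).toFun p ((P.idn n).toFun p a) = (Q.idn n).toFun p ((toHom n).toFun p a)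
  map_star : ∀ {k l : ℕ} (h : k < l) {p : ℕ+} (a b : P.C l p) (h₁ h₂),
    (toHom l).toFun p (P.star h a b h₁) =
      Q.star h ((toHom l).toFun p a) ((toHom l).toFun p b) h₂

/-- `f : a → b`: the `(n+1)`-cell `f` has source `a` and target `b`. -/
def OmegaOperad.IsCell {K : Type u} [Field K] (P : OmegaOperad.{u, v} K) {n : ℕ} {p : ℕ+}
    (f : P.C (n + 1) p) (a b : P.C n p) : Prop :=
  (P.src n).toFun p f = a ∧ (P.tgt n).toFun p f = b

/-- `a ∼_ω b`: there is an `(n+1)`-cell from `a` to `b`. -/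
def OmegaOperad.OmegaEquiv {K : Type u} [Field K] (P : OmegaOperad.{u, v} K) {n : ℕ} {p : ℕ+}
    (a b : P.C n p) : Prop :=
  ∃ f : P.C (n + 1) p, P.IsCell f a b

/-- Two `(n+1)`-cells are parallel if they have the same source and the same target. -/
def OmegaOperad.Parallel {K : Type u} [Field K] (P : OmegaOperad.{u, v} K) {n : ℕ} {p : ℕ+}
    (a b : P.C (n + 1) p) : Prop :=
  (P.src n).toFun p a = (P.src n).toFun p b ∧ (P.tgt n).toFun p a = (P.tgt n).toFun p b

/-- Weak equivalences of shuffle `ω`-operads. -/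
structure OmegaOperad.Hom.IsWeakEquivalence {K : Type u} [Field K] {P : OmegaOperad.{u, v} K}
    {Q : OmegaOperad.{u, w} K} (F : OmegaOperad.Hom P Q) : Prop where
  surj : ∀ p (a : Q.C 0 p), ∃ a' : P.C 0 p, Q.OmegaEquiv ((F.toHom 0).toFun p a') a
  lift_one : ∀ p (a b : P.C 0 p) (f : Q.C 1 p),
    Q.IsCell f ((F.toHom 0).toFun p a) ((F.toHom 0).toFun p b) →
    ∃ f' : P.C 1 p, P.IsCell f' a b ∧ Q.OmegaEquiv ((F.toHom 1).toFun p f') f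
  lift_succ : ∀ n p (a b : P.C (n + 1) p), P.Parallel a b → ∀ f : Q.C (n + 2) p,
    Q.IsCell f ((F.toHom (n + 1)).toFun p a) ((F.toHom (n + 1)).toFun p b) →
    ∃ f' : P.C (n + 2) p, P.IsCell f' a b ∧ Q.OmegaEquiv ((F.toHom (n + 2)).toFun p f') f

/-! ## From reflexive globular operads to ω-operads -/

namespace GlobOperad

variable {K : Type u} [Field K] (P : GlobOperad.{u, v} K)

theorem srcTo_self {k : ℕ} (h : k ≤ k) {p : ℕ+} (a : P.C k p) : P.srcTo h a = a :=
  descend_self (A := fun n => P.C n p) _ h a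

theorem tgtTo_self {k : ℕ} (h : k ≤ k) {p : ℕ+} (a : P.C k p) : P.tgtTo h a = a :=
  descend_self (A := fun n => P.C n p) _ h a

theorem idTo_self {k : ℕ} (h : k ≤ k) {p : ℕ+} (a : P.C k p) : P.idTo h a = a :=
  ascend_self (A := fun n => P.C n p) _ h a

theorem srcTo_succ {k l : ℕ} (h : k ≤ l) (h' : k ≤ l + 1) {p : ℕ+} (a : P.C (l + 1) p) :
    P.srcTo h' a = P.srcTo h ((P.src l).toFun p a) :=
  descend_succ (A := fun n => P.C n p) _ h h' a

theorem tgtTo_succ {k l : ℕ} (h : k ≤ l) (h' : k ≤ l + 1) {p : ℕ+} (a : P.C (l + 1) p) :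
    P.tgtTo h' a = P.tgtTo h ((P.tgt l).toFun p a) :=
  descend_succ (A := fun n => P.C n p) _ h h' a

theorem idTo_succ {k l : ℕ} (h : k ≤ l) (h' : k ≤ l + 1) {p : ℕ+} (a : P.C k p) :
    P.idTo h' a = (P.idn l).toFun p (P.idTo h a) :=
  ascend_succ (A := fun n => P.C n p) _ h h' a

theorem exists_srcHom {k l : ℕ} (h : k ≤ l) : ∃ F : ShuffleOperad.Hom (P.cell l) (P.cell k),
    ∀ p (a : P.C l p), P.srcTo h a = F.toFun p a := by
  induction l, h using Nat.le_induction with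
  | base => exact ⟨⟨fun _ => LinearMap.id, rfl, fun _ _ _ => rfl⟩, fun p a => P.srcTo_self _ a⟩
  | succ l h ih =>
    obtain ⟨F, hF⟩ := ih
    refine ⟨⟨fun p => (F.toFun p).comp ((P.src l).toFun p), ?_, fun f x y => ?_⟩, fun p a => ?_⟩
    · simp [(P.src l).map_unit, F.map_unit]
    · simp [(P.src l).map_comp, F.map_comp]
    · rw [P.srcTo_succ h, hF]; rfl

theorem exists_tgtHom {k l : ℕ} (h : k ≤ l) : ∃ F : ShuffleOperad.Hom (P.cell l) (P.cell k),
    ∀ p (a : P.C l p), P.tgtTo h a = F.toFun p a := by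
  induction l, h using Nat.le_induction with
  | base => exact ⟨⟨fun _ => LinearMap.id, rfl, fun _ _ _ => rfl⟩, fun p a => P.tgtTo_self _ a⟩
  | succ l h ih =>
    obtain ⟨F, hF⟩ := ih
    refine ⟨⟨fun p => (F.toFun p).comp ((P.tgt l).toFun p), ?_, fun f x y => ?_⟩, fun p a => ?_⟩
    · simp [(P.tgt l).map_unit, F.map_unit]
    · simp [(P.tgt l).map_comp, F.map_comp]
    · rw [P.tgtTo_succ h, hF]; rfl

theorem exists_idHom {k l : ℕ} (h : k ≤ l) : ∃ F : ShuffleOperad.Hom (P.cell k) (P.cell l),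
    ∀ p (a : P.C k p), P.idTo h a = F.toFun p a := by
  induction l, h using Nat.le_induction with
  | base => exact ⟨⟨fun _ => LinearMap.id, rfl, fun _ _ _ => rfl⟩, fun p a => P.idTo_self _ a⟩
  | succ l h ih =>
    obtain ⟨F, hF⟩ := ih
    refine ⟨⟨fun p => ((P.idn l).toFun p).comp (F.toFun p), ?_, fun f x y => ?_⟩, fun p a => ?_⟩
    · simp [(P.idn l).map_unit, F.map_unit]
    · simp [(P.idn l).map_comp, F.map_comp]
    · rw [P.idTo_succ h, hF]; rfl

theorem srcTo_idTo {k l : ℕ} (h : k ≤ l) {p : ℕ+} (a : P.C k p) :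
    P.srcTo h (P.idTo h a) = a := by
  induction l, h using Nat.le_induction with
  | base => rw [P.srcTo_self, P.idTo_self]
  | succ l h ih => rw [P.srcTo_succ h, P.idTo_succ h, P.src_idn, ih]

theorem tgtTo_idTo {k l : ℕ} (h : k ≤ l) {p : ℕ+} (a : P.C k p) :
    P.tgtTo h (P.idTo h a) = a := by
  induction l, h using Nat.le_induction with
  | base => rw [P.tgtTo_self, P.idTo_self]
  | succ l h ih => rw [P.tgtTo_succ h, P.idTo_succ h, P.tgt_idn, ih]

theorem idTo_idTo {j k l : ℕ} (hj : j ≤ k) (hk : k ≤ l) {p : ℕ+} (a : P.C j p) :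
    P.idTo hk (P.idTo hj a) = P.idTo (hj.trans hk) a := by
  induction l, hk using Nat.le_induction with
  | base => rw [P.idTo_self]
  | succ l h ih => rw [P.idTo_succ h, ih, ← P.idTo_succ (hj.trans h)]

theorem srcTo_srcTo {j k l : ℕ} (hj : j ≤ k) (hk : k ≤ l) {p : ℕ+} (a : P.C l p) :
    P.srcTo hj (P.srcTo hk a) = P.srcTo (hj.trans hk) a := by
  induction l, hk using Nat.le_induction with
  | base => rw [P.srcTo_self]
  | succ l h ih => rw [P.srcTo_succ h, ih, ← P.srcTo_succ (hj.trans h)]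

theorem tgtTo_tgtTo {j k l : ℕ} (hj : j ≤ k) (hk : k ≤ l) {p : ℕ+} (a : P.C l p) :
    P.tgtTo hj (P.tgtTo hk a) = P.tgtTo (hj.trans hk) a := by
  induction l, hk using Nat.le_induction with
  | base => rw [P.tgtTo_self]
  | succ l h ih => rw [P.tgtTo_succ h, ih, ← P.tgtTo_succ (hj.trans h)]

theorem srcTo_tgt {j l : ℕ} (h : j < l) {p : ℕ+} (a : P.C (l + 1) p) :
    P.srcTo h.le ((P.tgt l).toFun p a) = P.srcTo h.le ((P.src l).toFun p a) := by
  obtain ⟨l, rfl⟩ := Nat.exists_eq_succ_of_ne_zero (Nat.ne_zero_of_lt h)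
  rw [P.srcTo_succ (Nat.le_of_lt_succ h), P.srcTo_succ (Nat.le_of_lt_succ h), P.src_src]

theorem tgtTo_src {j l : ℕ} (h : j < l) {p : ℕ+} (a : P.C (l + 1) p) :
    P.tgtTo h.le ((P.src l).toFun p a) = P.tgtTo h.le ((P.tgt l).toFun p a) := by
  obtain ⟨l, rfl⟩ := Nat.exists_eq_succ_of_ne_zero (Nat.ne_zero_of_lt h)
  rw [P.tgtTo_succ (Nat.le_of_lt_succ h), P.tgtTo_succ (Nat.le_of_lt_succ h), P.tgt_tgt]

theorem srcTo_tgtTo {j k l : ℕ} (hj : j < k) (hk : k ≤ l) {p : ℕ+} (a : P.C l p) :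
    P.srcTo hj.le (P.tgtTo hk a) = P.srcTo (hj.le.trans hk) a := by
  induction l, hk using Nat.le_induction with
  | base => rw [P.tgtTo_self]
  | succ l h ih =>
    rw [P.tgtTo_succ h, ih, P.srcTo_tgt (hj.trans_le h), ← P.srcTo_succ (hj.le.trans h)]

theorem tgtTo_srcTo {j k l : ℕ} (hj : j < k) (hk : k ≤ l) {p : ℕ+} (a : P.C l p) :
    P.tgtTo hj.le (P.srcTo hk a) = P.tgtTo (hj.le.trans hk) a := by
  induction l, hk using Nat.le_induction with
  | base => rw [P.srcTo_self]
  | succ l h ih =>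
    rw [P.srcTo_succ h, ih, P.tgtTo_src (hj.trans_le h), ← P.tgtTo_succ (hj.le.trans h)]

/-- The exchange relation between the operadic composition and the linear expression
`a ⋆_k b = a - t_k(a) + b`. -/
def Exchange : Prop :=
  ∀ {k l : ℕ} (h : k < l) {q n : ℕ+} {m : Fin q → ℕ+} (f : ShuffleSurj m n)
    (x x' : P.C l q) (y y' : ∀ i, P.C l (m i)), P.tgtTo h.le x = P.srcTo h.le x' →
    (∀ i, P.tgtTo h.le (y i) = P.srcTo h.le (y' i)) →
    (P.cell l).comp f (x - P.idTo h.le (P.tgtTo h.le x) + x')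
        (fun i => y i - P.idTo h.le (P.tgtTo h.le (y i)) + y' i) =
      (P.cell l).comp f x y - P.idTo h.le (P.tgtTo h.le ((P.cell l).comp f x y)) +
        (P.cell l).comp f x' y'

/-- A reflexive globular operad that satisfies the exchange relation is a shuffle `ω`-operad, with
`a ⋆_k b = a - t_k(a) + b`. -/
abbrev toOmegaOperad (hP : P.Exchange) : OmegaOperad.{u, v} K where
  toGlobOperad := P
  star h _ a b _ := a - P.idTo h.le (P.tgtTo h.le a) + b
  star_add h p a b a' b' _ _ _ := by
    obtain ⟨T, hT⟩ := P.exists_tgtHom h.le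
    obtain ⟨I, hI⟩ := P.exists_idHom h.le
    simp only [hT, hI, map_add]; abel
  star_smul h p r a b _ _ := by
    obtain ⟨T, hT⟩ := P.exists_tgtHom h.le
    obtain ⟨I, hI⟩ := P.exists_idHom h.le
    simp only [hT, hI, map_smul, smul_add, smul_sub]
  star_unit h _ := by
    obtain ⟨T, hT⟩ := P.exists_tgtHom h.le
    obtain ⟨I, hI⟩ := P.exists_idHom h.le
    simp only [hT, hI, T.map_unit, I.map_unit]; abel
  star_comp h _ _ _ f x x' y y' h₁ h₂ _ := hP h f x x' y y' h₁ h₂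
  src_star h p a b hab := by
    obtain ⟨S, hS⟩ := P.exists_srcHom h.le
    have := P.srcTo_idTo h.le (P.tgtTo h.le a)
    simp only [hS, map_add, map_sub] at *
    rw [this, hab]; abel
  tgt_star h p a b hab := by
    obtain ⟨T, hT⟩ := P.exists_tgtHom h.le
    have := P.tgtTo_idTo h.le (P.tgtTo h.le a)
    simp only [hT, map_add, map_sub] at *
    rw [this]; abel
  star_assoc h p a b c hab _ _ _ := by
    obtain ⟨T, hT⟩ := P.exists_tgtHom h.le
    have := P.tgtTo_idTo h.le (P.tgtTo h.le a)
    simp only [hT, map_add, map_sub] at *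
    rw [this]
    have e : T.toFun p a - T.toFun p a + T.toFun p b = T.toFun p b := by abel
    rw [e]; abel
  id_star h p a _ := by
    rw [P.tgtTo_idTo]; abel
  star_id h p a _ := by abel
  srcTo_star {j k l} hj hk p a b _ _ := by
    have e := P.srcTo_idTo hk.le (P.idTo hj.le (P.tgtTo (hj.trans hk).le a))
    rw [P.idTo_idTo] at e
    have e' := P.tgtTo_srcTo hj hk.le a
    obtain ⟨S, hS⟩ := P.exists_srcHom hk.le
    simp only [hS, map_add, map_sub] at *
    rw [e, e']
  tgtTo_star {j k l} hj hk p a b _ _ := by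
    have e := P.tgtTo_idTo hk.le (P.idTo hj.le (P.tgtTo (hj.trans hk).le a))
    rw [P.idTo_idTo] at e
    have e' := P.tgtTo_tgtTo hj.le hk.le a
    obtain ⟨T, hT⟩ := P.exists_tgtHom hk.le
    simp only [hT, map_add, map_sub] at *
    rw [e, e']
  idTo_star {j k l} hj hk p a b _ _ := by
    have e := P.idTo_idTo hj.le hk.le (P.tgtTo hj.le a)
    have e' := P.tgtTo_tgtTo hj.le hk.le (P.idTo hk.le a)
    rw [P.tgtTo_idTo] at e'
    obtain ⟨I, hI⟩ := P.exists_idHom hk.le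
    simp only [hI, map_add, map_sub] at *
    rw [e, ← e']
  star_exchange {j k l} hj hk p a a' b b' haa' hbb' _ hab ha'b' _ := by
    have hjl := hj.trans hk
    -- `j`-targets are not changed by `⋆_k`
    have e₁ : P.tgtTo hjl.le a' = P.tgtTo hjl.le a := by
      rw [← P.tgtTo_srcTo hj hk.le a', ← haa', P.tgtTo_tgtTo]
    have e₂ := P.tgtTo_idTo hk.le (P.tgtTo hk.le a)
    have e₃ : P.tgtTo hjl.le (P.idTo hk.le (P.tgtTo hk.le a)) = P.tgtTo hjl.le a := by
      rw [← P.tgtTo_tgtTo hj.le hk.le, e₂, P.tgtTo_tgtTo]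
    have e₄ := P.tgtTo_idTo hk.le (P.idTo hj.le (P.tgtTo hjl.le a))
    rw [P.idTo_idTo] at e₄
    have e₅ := P.idTo_idTo hj.le hk.le (P.tgtTo hjl.le a)
    obtain ⟨T, hT⟩ := P.exists_tgtHom hk.le
    obtain ⟨T', hT'⟩ := P.exists_tgtHom hjl.le
    obtain ⟨I, hI⟩ := P.exists_idHom hk.le
    obtain ⟨I', hI'⟩ := P.exists_idHom hjl.le
    simp only [hT, hT', hI, hI', map_add, map_sub] at *
    rw [e₁, e₃, e₄, e₅]
    abel

end GlobOperad

/-- In a shuffle `ω`-operad, linearity and the unit laws force `a ⋆_k b = a - t_k(a) + b`. -/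
theorem OmegaOperad.star_eq {K : Type u} [Field K] (P : OmegaOperad.{u, v} K) {k l : ℕ}
    (h : k < l) {p : ℕ+} (a b : P.C l p) (hab : P.tgtTo h.le a = P.srcTo h.le b) :
    P.star h a b hab = a - P.idTo h.le (P.tgtTo h.le a) + b := by
  obtain ⟨S, hS⟩ := P.exists_srcHom h.le
  obtain ⟨T, hT⟩ := P.exists_tgtHom h.le
  set c := P.idTo h.le (P.tgtTo h.le a) with hc
  have htc : P.tgtTo h.le c = P.tgtTo h.le a := P.tgtTo_idTo h.le _
  have hsc : P.srcTo h.le c = P.tgtTo h.le a := P.srcTo_idTo h.le _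
  have h1 : P.tgtTo h.le a = P.srcTo h.le c := hsc.symm
  have h2 : P.tgtTo h.le (b - c) = P.srcTo h.le (b - c) + (P.tgtTo h.le (b - c)) := by
    simp only [hS, hT, map_sub] at *
    rw [hsc, hab]; abel
  have e1 : P.star h a c h1 = a := P.star_id h a h1
  have h3 : P.tgtTo h.le (0 : P.C l p) = P.srcTo h.le (b - c) := by
    simp only [hS, hT, map_sub, map_zero] at *
    rw [hsc, hab]; abel
  have e2 : P.star h 0 (b - c) h3 = b - c := by
    have := P.id_star h (b - c)
    have z : P.idTo h.le (P.srcTo h.le (b - c)) = 0 := by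
      obtain ⟨I, hI⟩ := P.exists_idHom h.le
      rw [← h3, hT, map_zero, hI, map_zero]
    simpa only [z] using this (by rw [z, h3])
  have h4 : P.tgtTo h.le (a + 0) = P.srcTo h.le (c + (b - c)) := by
    simp only [add_zero, add_sub_cancel]; exact hab
  have e3 := P.star_add h a c 0 (b - c) h1 h3 h4
  rw [e1, e2] at e3
  simp only [add_zero, add_sub_cancel] at e3
  rw [e3]; abel

/-! ## Shuffle polygraphs and their free ω-operads -/

/-- Formal expressions for the `n`-cells of arity `k` of the free `ω`-operad on indexed sets of
generators `X n`: generators, operadic units, identities on `(n-1)`-cells, linear combinations and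
operadic compositions. Composites `a ⋆_k b` need no constructor, by `OmegaOperad.star_eq`. -/
inductive Expr (K : Type u) (X : ℕ → ℕ+ → Type v) : ℕ → ℕ+ → Type (max u v)
  | gen {n : ℕ} {k : ℕ+} (x : X n k) : Expr K X n k
  | unit (n : ℕ) : Expr K X n 1
  | idn {n : ℕ} {k : ℕ+} (a : Expr K X n k) : Expr K X (n + 1) k
  | zero (n : ℕ) (k : ℕ+) : Expr K X n k
  | add {n : ℕ} {k : ℕ+} (a b : Expr K X n k) : Expr K X n k
  | smul {n : ℕ} {k : ℕ+} (r : K) (a : Expr K X n k) : Expr K X n k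
  | comp {n : ℕ} {k N : ℕ+} {m : Fin k → ℕ+} (f : ShuffleSurj m N) (x : Expr K X n k)
      (y : ∀ i, Expr K X n (m i)) : Expr K X n N

namespace Expr

variable {K : Type u} {X : ℕ → ℕ+ → Type v}

/-- Auxiliary to `bdry`: the boundary of a generator (dimension `0` is left alone). -/
def bdryGen (d : ∀ n k, X (n + 1) k → Expr K X n k) :
    ∀ {n : ℕ} {k : ℕ+}, X n k → Expr K X (n - 1) k
  | 0, _, x => gen x
  | _ + 1, _, x => d _ _ x

/-- Auxiliary to `bdry`: the boundary of an expression (dimension `0` is left alone). -/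
def bdryAux (d : ∀ n k, X (n + 1) k → Expr K X n k) :
    ∀ {n : ℕ} {k : ℕ+}, Expr K X n k → Expr K X (n - 1) k
  | _, _, gen x => bdryGen d x
  | _, _, unit _ => unit _
  | _, _, idn a => a
  | _, _, zero _ _ => zero _ _
  | _, _, add a b => add (bdryAux d a) (bdryAux d b)
  | _, _, smul r a => smul r (bdryAux d a)
  | _, _, comp f x y => comp f (bdryAux d x) (fun i => bdryAux d (y i))

/-- The extension of a boundary map `d` (the source or the target) from generators to expressions of
dimension `n + 1`: the morphism of operads that sends a generator `x` to `d x` and an identity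
`idn a` to `a`. -/
def bdry (d : ∀ n k, X (n + 1) k → Expr K X n k) {n : ℕ} {k : ℕ+} (a : Expr K X (n + 1) k) :
    Expr K X n k :=
  bdryAux d a

/-- The iterated boundary, from dimension `l` down to dimension `k`. -/
def bdryTo (d : ∀ n k, X (n + 1) k → Expr K X n k) {k l : ℕ} (h : k ≤ l) {p : ℕ+} :
    Expr K X l p → Expr K X k p :=
  descend (A := fun n => Expr K X n p) (fun _ => bdry d) h

/-- The iterated identity, from dimension `k` up to dimension `l`. -/
def idTo {k l : ℕ} (h : k ≤ l) {p : ℕ+} : Expr K X k p → Expr K X l p :=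
  ascend (A := fun n => Expr K X n p) (fun _ => idn) h

/-- The expression `a - t_k(a) + b`. -/
def star [Field K] (t : ∀ n k, X (n + 1) k → Expr K X n k) {k l : ℕ} (h : k ≤ l) {p : ℕ+}
    (a b : Expr K X l p) : Expr K X l p :=
  add (add a (smul (-1) (idTo h (bdryTo t h a)))) b

end Expr

/-- Generators in every dimension and arity, and, for each `(n+1)`-generator, expressions for its
source and its target, which are `n`-cells of the free operad on the generators of dimension
`≤ n` (every such cell is the class of an expression; only the classes matter below). -/
structure PrePolygraph (K : Type u) where
  gen : ℕ → ℕ+ → Type v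
  src : ∀ n k, gen (n + 1) k → Expr K gen n k
  tgt : ∀ n k, gen (n + 1) k → Expr K gen n k

/-- Equality of expressions in the free `ω`-operad: the smallest congruence for which the vector
space axioms, the operad axioms, the fact that identities form morphisms of operads, and the
exchange relations between the composition of operads and the `⋆_k` hold. In dimension `n`, it only
involves generators of dimension `≤ n`, and their boundaries. -/
inductive PrePolygraph.Rel {K : Type u} [Field K] (X : PrePolygraph.{u, v} K) :
    ∀ {n : ℕ} {k : ℕ+}, Expr K X.gen n k → Expr K X.gen n k → Prop
  | refl {n : ℕ} {k : ℕ+} (a : Expr K X.gen n k) : X.Rel a a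
  | symm {n : ℕ} {k : ℕ+} {a b : Expr K X.gen n k} : X.Rel a b → X.Rel b a
  | trans {n : ℕ} {k : ℕ+} {a b c : Expr K X.gen n k} : X.Rel a b → X.Rel b c → X.Rel a c
  | add_congr {n : ℕ} {k : ℕ+} {a a' b b' : Expr K X.gen n k} :
      X.Rel a a' → X.Rel b b' → X.Rel (.add a b) (.add a' b')
  | smul_congr {n : ℕ} {k : ℕ+} (r : K) {a a' : Expr K X.gen n k} :
      X.Rel a a' → X.Rel (.smul r a) (.smul r a')
  | comp_congr {n : ℕ} {k N : ℕ+} {m : Fin k → ℕ+} (f : ShuffleSurj m N)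
      {x x' : Expr K X.gen n k} {y y' : ∀ i, Expr K X.gen n (m i)} :
      X.Rel x x' → (∀ i, X.Rel (y i) (y' i)) → X.Rel (.comp f x y) (.comp f x' y')
  | idn_congr {n : ℕ} {k : ℕ+} {a a' : Expr K X.gen n k} :
      X.Rel a a' → X.Rel (.idn a) (.idn a')
  -- vector spaces
  | add_assoc {n : ℕ} {k : ℕ+} (a b c : Expr K X.gen n k) :
      X.Rel (.add (.add a b) c) (.add a (.add b c))
  | add_comm {n : ℕ} {k : ℕ+} (a b : Expr K X.gen n k) : X.Rel (.add a b) (.add b a)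
  | add_zero {n : ℕ} {k : ℕ+} (a : Expr K X.gen n k) : X.Rel (.add a (.zero n k)) a
  | add_neg {n : ℕ} {k : ℕ+} (a : Expr K X.gen n k) :
      X.Rel (.add a (.smul (-1) a)) (.zero n k)
  | smul_add {n : ℕ} {k : ℕ+} (r : K) (a b : Expr K X.gen n k) :
      X.Rel (.smul r (.add a b)) (.add (.smul r a) (.smul r b))
  | add_smul {n : ℕ} {k : ℕ+} (r s : K) (a : Expr K X.gen n k) :
      X.Rel (.smul (r + s) a) (.add (.smul r a) (.smul s a))
  | mul_smul {n : ℕ} {k : ℕ+} (r s : K) (a : Expr K X.gen n k) :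
      X.Rel (.smul (r * s) a) (.smul r (.smul s a))
  | one_smul {n : ℕ} {k : ℕ+} (a : Expr K X.gen n k) : X.Rel (.smul 1 a) a
  -- operads
  | comp_add_left {n : ℕ} {k N : ℕ+} {m : Fin k → ℕ+} (f : ShuffleSurj m N)
      (x x' : Expr K X.gen n k) (y : ∀ i, Expr K X.gen n (m i)) :
      X.Rel (.comp f (.add x x') y) (.add (.comp f x y) (.comp f x' y))
  | comp_smul_left {n : ℕ} {k N : ℕ+} {m : Fin k → ℕ+} (f : ShuffleSurj m N) (r : K)
      (x : Expr K X.gen n k) (y : ∀ i, Expr K X.gen n (m i)) :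
      X.Rel (.comp f (.smul r x) y) (.smul r (.comp f x y))
  | comp_add_right {n : ℕ} {k N : ℕ+} {m : Fin k → ℕ+} (f : ShuffleSurj m N)
      (x : Expr K X.gen n k) (y : ∀ i, Expr K X.gen n (m i)) (i : Fin k)
      (a b : Expr K X.gen n (m i)) :
      X.Rel (.comp f x (Function.update y i (.add a b)))
        (.add (.comp f x (Function.update y i a)) (.comp f x (Function.update y i b)))
  | comp_smul_right {n : ℕ} {k N : ℕ+} {m : Fin k → ℕ+} (f : ShuffleSurj m N)
      (x : Expr K X.gen n k) (y : ∀ i, Expr K X.gen n (m i)) (i : Fin k) (r : K)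
      (a : Expr K X.gen n (m i)) :
      X.Rel (.comp f x (Function.update y i (.smul r a)))
        (.smul r (.comp f x (Function.update y i a)))
  | unit_comp {n : ℕ} {N : ℕ+} (f : ShuffleSurj (k := 1) (fun _ => N) N)
      (x : Expr K X.gen n N) : X.Rel (.comp f (.unit n) (fun _ => x)) x
  | comp_unit {n : ℕ} {N : ℕ+} (f : ShuffleSurj (k := N) (fun _ => 1) N)
      (x : Expr K X.gen n N) : X.Rel (.comp f x (fun _ => .unit n)) x
  | comp_assoc {n : ℕ} {k q N : ℕ+} {m p : Fin k → ℕ+} {l : Fin q → ℕ+}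
      (f : ShuffleSurj m q) (g : ShuffleSurj l N)
      (h : ∀ i, ShuffleSurj (fun j : Fin (m i) => l (f.emb i j)) (p i)) (e : ShuffleSurj p N)
      (he : ∀ i j a, e.emb i ((h i).emb j a) = g.emb (f.emb i j) a)
      (x : Expr K X.gen n k) (y : ∀ i, Expr K X.gen n (m i)) (z : ∀ j, Expr K X.gen n (l j)) :
      X.Rel (.comp g (.comp f x y) z)
        (.comp e x (fun i => .comp (h i) (y i) (fun j => z (f.emb i j))))
  -- identities are morphisms of operads
  | idn_add {n : ℕ} {k : ℕ+} (a b : Expr K X.gen n k) :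
      X.Rel (.idn (.add a b)) (.add (.idn a) (.idn b))
  | idn_smul {n : ℕ} {k : ℕ+} (r : K) (a : Expr K X.gen n k) :
      X.Rel (.idn (.smul r a)) (.smul r (.idn a))
  | idn_unit (n : ℕ) : X.Rel (.idn (.unit n)) (.unit (n + 1))
  | idn_comp {n : ℕ} {k N : ℕ+} {m : Fin k → ℕ+} (f : ShuffleSurj m N)
      (x : Expr K X.gen n k) (y : ∀ i, Expr K X.gen n (m i)) :
      X.Rel (.idn (.comp f x y)) (.comp f (.idn x) (fun i => .idn (y i)))
  -- exchange: `(x ⋆_k x' ∣_f y ⋆_k y') = (x ∣_f y) ⋆_k (x' ∣_f y')`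
  | exchange {k l : ℕ} (h : k < l) {q N : ℕ+} {m : Fin q → ℕ+} (f : ShuffleSurj m N)
      {x x' : Expr K X.gen l q} {y y' : ∀ i, Expr K X.gen l (m i)} :
      X.Rel (Expr.bdryTo X.tgt h.le x) (Expr.bdryTo X.src h.le x') →
      (∀ i, X.Rel (Expr.bdryTo X.tgt h.le (y i)) (Expr.bdryTo X.src h.le (y' i))) →
      X.Rel (.comp f (Expr.star X.tgt h.le x x') (fun i => Expr.star X.tgt h.le (y i) (y' i)))
        (Expr.star X.tgt h.le (.comp f x y) (.comp f x' y'))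

/-- A shuffle `ω`-polygraph: for each `n`, the `(n+1)`-generators form a cellular extension of the
free `n`-operad on the generators of dimension `≤ n`, that is, their sources and targets satisfy the
globular relations there. -/
structure OmegaPolygraph (K : Type u) [Field K] extends PrePolygraph.{u, v} K where
  src_src : ∀ n k (x : gen (n + 2) k),
    toPrePolygraph.Rel (Expr.bdry src (src (n + 1) k x)) (Expr.bdry src (tgt (n + 1) k x))
  tgt_tgt : ∀ n k (x : gen (n + 2) k),
    toPrePolygraph.Rel (Expr.bdry tgt (src (n + 1) k x)) (Expr.bdry tgt (tgt (n + 1) k x))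

namespace PrePolygraph

variable {K : Type u} [Field K] (X : PrePolygraph.{u, v} K)

/-- Expressions for `n`-cells, with their operadic operations, up to `Rel`. -/
def exprOperad (n : ℕ) : OperadUpTo.{u, max u v} K where
  obj := Expr K X.gen n
  rel := X.Rel
  refl := .refl
  symm := .symm
  trans := .trans
  zero := .zero n
  add := .add
  smul := .smul
  unit := .unit n
  comp := .comp
  add_congr := .add_congr
  smul_congr := .smul_congr
  comp_congr := .comp_congr
  add_assoc := .add_assoc
  add_comm := .add_comm
  add_zero := .add_zero
  add_neg := .add_neg
  smul_add := .smul_add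
  add_smul := .add_smul
  mul_smul := .mul_smul
  one_smul := .one_smul
  comp_add_left := .comp_add_left
  comp_smul_left := .comp_smul_left
  comp_add_right := .comp_add_right
  comp_smul_right := .comp_smul_right
  unit_comp := .unit_comp
  comp_unit := .comp_unit
  comp_assoc := .comp_assoc

end PrePolygraph

namespace OmegaPolygraph

variable {K : Type u} [Field K] (X : OmegaPolygraph.{u, v} K)

/-- The shuffle operad of `n`-cells of the free `ω`-operad. -/
noncomputable def cell (n : ℕ) : ShuffleOperad.{u, max u v} K := (X.exprOperad n).quotient

/-- The cell denoted by an expression. -/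
def cls {n : ℕ} {k : ℕ+} (a : Expr K X.gen n k) : (X.cell n).obj k := (X.exprOperad n).cls a

theorem cls_eq {n : ℕ} {k : ℕ+} {a b : Expr K X.gen n k} : X.cls a = X.cls b ↔ X.Rel a b :=
  (X.exprOperad n).cls_eq

theorem cls_ind {n : ℕ} {k : ℕ+} {C : (X.cell n).obj k → Prop} (h : ∀ a, C (X.cls a))
    (q : (X.cell n).obj k) : C q := (X.exprOperad n).ind h q

theorem cls_ind_pi {n : ℕ} {k : ℕ+} {m : Fin k → ℕ+} {C : (∀ i, (X.cell n).obj (m i)) → Prop}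
    (h : ∀ a : ∀ i, Expr K X.gen n (m i), C (fun i => X.cls (a i)))
    (q : ∀ i, (X.cell n).obj (m i)) : C q := (X.exprOperad n).ind_pi h q

theorem cls_add {n : ℕ} {k : ℕ+} (a b : Expr K X.gen n k) :
    X.cls (.add a b) = X.cls a + X.cls b := rfl

theorem cls_smul {n : ℕ} {k : ℕ+} (r : K) (a : Expr K X.gen n k) :
    X.cls (.smul r a) = r • X.cls a := rfl

theorem cls_zero (n : ℕ) (k : ℕ+) : X.cls (.zero n k) = 0 := rfl

theorem cls_unit (n : ℕ) : X.cls (.unit n) = (X.cell n).unit := rfl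

theorem cls_comp {n : ℕ} {k N : ℕ+} {m : Fin k → ℕ+} (f : ShuffleSurj m N)
    (x : Expr K X.gen n k) (y : ∀ i, Expr K X.gen n (m i)) :
    X.cls (.comp f x y) = (X.cell n).comp f (X.cls x) (fun i => X.cls (y i)) :=
  (X.exprOperad n).cls_comp f x y

theorem cls_star {k l : ℕ} (h : k ≤ l) {p : ℕ+} (a b : Expr K X.gen l p) :
    X.cls (Expr.star X.tgt h a b) =
      X.cls a - X.cls (Expr.idTo h (Expr.bdryTo X.tgt h a)) + X.cls b := by
  simp only [Expr.star, cls_add, cls_smul, neg_smul, _root_.one_smul, sub_eq_add_neg]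

theorem bdryTo_succ (d : ∀ n k, X.gen (n + 1) k → Expr K X.gen n k) {k l : ℕ} (h : k ≤ l)
    (h' : k ≤ l + 1) {p : ℕ+} (a : Expr K X.gen (l + 1) p) :
    Expr.bdryTo d h' a = Expr.bdryTo d h (Expr.bdry d a) :=
  descend_succ (A := fun n => Expr K X.gen n p) _ h h' a

theorem bdryTo_self (d : ∀ n k, X.gen (n + 1) k → Expr K X.gen n k) {k : ℕ} (h : k ≤ k) {p : ℕ+}
    (a : Expr K X.gen k p) : Expr.bdryTo d h a = a :=
  descend_self (A := fun n => Expr K X.gen n p) _ h a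

theorem idTo_succ {k l : ℕ} (h : k ≤ l) (h' : k ≤ l + 1) {p : ℕ+} (a : Expr K X.gen k p) :
    (Expr.idTo h' a : Expr K X.gen (l + 1) p) = .idn (Expr.idTo h a) :=
  ascend_succ (A := fun n => Expr K X.gen n p) _ h h' a

theorem idTo_self {k : ℕ} (h : k ≤ k) {p : ℕ+} (a : Expr K X.gen k p) :
    (Expr.idTo h a : Expr K X.gen k p) = a :=
  ascend_self (A := fun n => Expr K X.gen n p) _ h a

theorem rel_src_aux {n : ℕ} {k : ℕ+} (a : Expr K X.gen n k) (hn : 2 ≤ n) :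
    X.Rel (Expr.bdryAux X.src (Expr.bdryAux X.src a))
      (Expr.bdryAux X.src (Expr.bdryAux X.tgt a)) := by
  induction a with
  | @gen n k x =>
    obtain ⟨n, rfl⟩ := Nat.exists_eq_add_of_le' hn
    exact X.src_src n k x
  | unit | idn | zero => exact .refl _
  | add a b iha ihb => exact .add_congr (iha hn) (ihb hn)
  | smul r a ih => exact .smul_congr r (ih hn)
  | comp f x y ihx ihy => exact .comp_congr f (ihx hn) (fun i => ihy i hn)

theorem rel_tgt_aux {n : ℕ} {k : ℕ+} (a : Expr K X.gen n k) (hn : 2 ≤ n) :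
    X.Rel (Expr.bdryAux X.tgt (Expr.bdryAux X.src a))
      (Expr.bdryAux X.tgt (Expr.bdryAux X.tgt a)) := by
  induction a with
  | @gen n k x =>
    obtain ⟨n, rfl⟩ := Nat.exists_eq_add_of_le' hn
    exact X.tgt_tgt n k x
  | unit | idn | zero => exact .refl _
  | add a b iha ihb => exact .add_congr (iha hn) (ihb hn)
  | smul r a ih => exact .smul_congr r (ih hn)
  | comp f x y ihx ihy => exact .comp_congr f (ihx hn) (fun i => ihy i hn)

theorem rel_src_src {n : ℕ} {k : ℕ+} (a : Expr K X.gen (n + 2) k) :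
    X.Rel (Expr.bdry X.src (Expr.bdry X.src a)) (Expr.bdry X.src (Expr.bdry X.tgt a)) :=
  X.rel_src_aux a (Nat.le_add_left 2 n)

theorem rel_tgt_tgt {n : ℕ} {k : ℕ+} (a : Expr K X.gen (n + 2) k) :
    X.Rel (Expr.bdry X.tgt (Expr.bdry X.src a)) (Expr.bdry X.tgt (Expr.bdry X.tgt a)) :=
  X.rel_tgt_aux a (Nat.le_add_left 2 n)

/-- The boundary map `d` respects equality of expressions of dimension `n + 1`. -/
def Respects (d : ∀ n k, X.gen (n + 1) k → Expr K X.gen n k) (n : ℕ) : Prop :=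
  ∀ {k : ℕ+} {a b : Expr K X.gen (n + 1) k}, X.Rel a b → X.Rel (Expr.bdry d a) (Expr.bdry d b)

theorem bdryTo_congr {d : ∀ n k, X.gen (n + 1) k → Expr K X.gen n k} {k l : ℕ} (h : k ≤ l)
    (hd : ∀ j < l, X.Respects d j) {p : ℕ+} {a b : Expr K X.gen l p} (hab : X.Rel a b) :
    X.Rel (Expr.bdryTo d h a) (Expr.bdryTo d h b) := by
  induction l, h using Nat.le_induction with
  | base => simpa only [bdryTo_self] using hab
  | succ l h ih =>
    rw [X.bdryTo_succ d h, X.bdryTo_succ d h]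
    exact ih (fun j hj => hd j (hj.trans l.lt_succ_self)) (hd l l.lt_succ_self hab)

theorem idTo_congr {k l : ℕ} (h : k ≤ l) {p : ℕ+} {a b : Expr K X.gen k p} (hab : X.Rel a b) :
    X.Rel (Expr.idTo h a : Expr K X.gen l p) (Expr.idTo h b) := by
  induction l, h using Nat.le_induction with
  | base => simpa only [idTo_self] using hab
  | succ l h ih => rw [X.idTo_succ h, X.idTo_succ h]; exact .idn_congr ih

theorem star_congr {k l : ℕ} (h : k ≤ l) (hd : ∀ j < l, X.Respects X.tgt j) {p : ℕ+}
    {a a' b b' : Expr K X.gen l p} (ha : X.Rel a a') (hb : X.Rel b b') :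
    X.Rel (Expr.star X.tgt h a b) (Expr.star X.tgt h a' b') :=
  .add_congr (.add_congr ha (.smul_congr _ (X.idTo_congr h (X.bdryTo_congr h hd ha)))) hb

theorem bdryAux_update {d : ∀ n k, X.gen (n + 1) k → Expr K X.gen n k} {n : ℕ} {k : ℕ+}
    {m : Fin k → ℕ+} (y : ∀ i, Expr K X.gen n (m i)) (i : Fin k) (a : Expr K X.gen n (m i)) :
    (fun j => Expr.bdryAux d (Function.update y i a j)) =
      Function.update (fun j => Expr.bdryAux d (y j)) i (Expr.bdryAux d a) := by
  funext j
  by_cases h : j = i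
  · subst h; simp
  · simp [Function.update_of_ne h]

/-- Both boundaries respect equality in dimensions below `l`. -/
def RespectsBelow (l : ℕ) : Prop :=
  ∀ j < l, X.Respects X.src j ∧ X.Respects X.tgt j

theorem tgtTo_bdry {d : ∀ n k, X.gen (n + 1) k → Expr K X.gen n k} (hd : d = X.src ∨ d = X.tgt)
    {k l : ℕ} (h : k < l) (hl : X.RespectsBelow l) {p : ℕ+} (a : Expr K X.gen (l + 1) p) :
    X.Rel (Expr.bdryTo X.tgt h.le (Expr.bdry d a))
      (Expr.bdryTo X.tgt (h.le.trans l.le_succ) a) := by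
  rw [X.bdryTo_succ _ h.le]
  rcases hd with rfl | rfl
  · obtain ⟨l, rfl⟩ := Nat.exists_eq_succ_of_ne_zero (Nat.ne_zero_of_lt h)
    rw [X.bdryTo_succ _ (Nat.le_of_lt_succ h), X.bdryTo_succ _ (Nat.le_of_lt_succ h)]
    exact X.bdryTo_congr _ (fun j hj => (hl j (hj.trans l.lt_succ_self)).2) (X.rel_tgt_tgt a)
  · exact .refl _

theorem srcTo_bdry {d : ∀ n k, X.gen (n + 1) k → Expr K X.gen n k} (hd : d = X.src ∨ d = X.tgt)
    {k l : ℕ} (h : k < l) (hl : X.RespectsBelow l) {p : ℕ+} (a : Expr K X.gen (l + 1) p) :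
    X.Rel (Expr.bdryTo X.src h.le (Expr.bdry d a))
      (Expr.bdryTo X.src (h.le.trans l.le_succ) a) := by
  rw [X.bdryTo_succ _ h.le]
  rcases hd with rfl | rfl
  · exact .refl _
  · obtain ⟨l, rfl⟩ := Nat.exists_eq_succ_of_ne_zero (Nat.ne_zero_of_lt h)
    rw [X.bdryTo_succ _ (Nat.le_of_lt_succ h), X.bdryTo_succ _ (Nat.le_of_lt_succ h)]
    exact X.bdryTo_congr _ (fun j hj => (hl j (hj.trans l.lt_succ_self)).1)
      (.symm (X.rel_src_src a))

theorem bdry_star {d : ∀ n k, X.gen (n + 1) k → Expr K X.gen n k} (hd : d = X.src ∨ d = X.tgt)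
    {k l : ℕ} (h : k < l) (hl : X.RespectsBelow l) {p : ℕ+} (a b : Expr K X.gen (l + 1) p) :
    X.Rel (Expr.bdry d (Expr.star X.tgt (h.le.trans l.le_succ) a b))
      (Expr.star X.tgt h.le (Expr.bdry d a) (Expr.bdry d b)) := by
  unfold Expr.star
  refine .add_congr (.add_congr (.refl _) (.smul_congr _ ?_)) (.refl _)
  rw [X.idTo_succ h.le]
  exact X.idTo_congr _ (.symm (X.tgtTo_bdry hd h hl a))

theorem bdry_star_top (d : ∀ n k, X.gen (n + 1) k → Expr K X.gen n k)
    {l : ℕ} (h : l ≤ l + 1) {p : ℕ+} (a b : Expr K X.gen (l + 1) p) :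
    X.cls (Expr.bdry d (Expr.star X.tgt h a b)) =
      X.cls (Expr.bdry d a) - X.cls (Expr.bdry X.tgt a) + X.cls (Expr.bdry d b) := by
  have e : Expr.bdry d (Expr.star X.tgt h a b) =
      .add (.add (Expr.bdry d a) (.smul (-1) (Expr.bdry X.tgt a))) (Expr.bdry d b) := by
    unfold Expr.star
    rw [X.idTo_succ le_rfl, X.bdryTo_succ _ le_rfl, X.idTo_self, X.bdryTo_self]
    rfl
  rw [e]
  simp only [cls_add, cls_smul, neg_smul, _root_.one_smul, sub_eq_add_neg]

theorem bdryAux_congr {d : ∀ n k, X.gen (n + 1) k → Expr K X.gen n k}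
    (hd : d = X.src ∨ d = X.tgt) {n : ℕ} {k : ℕ+} {a b : Expr K X.gen n k} (h : X.Rel a b)
    (hn : X.RespectsBelow (n - 1)) : X.Rel (Expr.bdryAux d a) (Expr.bdryAux d b) := by
  induction h with
  | refl a => exact .refl _
  | symm _ ih => exact .symm (ih hn)
  | trans _ _ ih ih' => exact .trans (ih hn) (ih' hn)
  | add_congr _ _ ih ih' => exact .add_congr (ih hn) (ih' hn)
  | smul_congr r _ ih => exact .smul_congr r (ih hn)
  | comp_congr f _ _ ih ih' => exact .comp_congr f (ih hn) (fun i => ih' i hn)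
  | idn_congr h _ => exact h
  | add_assoc a b c => exact .add_assoc _ _ _
  | add_comm a b => exact .add_comm _ _
  | add_zero a => exact .add_zero _
  | add_neg a => exact .add_neg _
  | smul_add r a b => exact .smul_add _ _ _
  | add_smul r s a => exact .add_smul _ _ _
  | mul_smul r s a => exact .mul_smul _ _ _
  | one_smul a => exact .one_smul _
  | comp_add_left f x x' y => exact .comp_add_left _ _ _ _
  | comp_smul_left f r x y => exact .comp_smul_left _ _ _ _
  | comp_add_right f x y i a b =>
    simp only [Expr.bdryAux, bdryAux_update]; exact .comp_add_right _ _ _ _ _ _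
  | comp_smul_right f x y i r a =>
    simp only [Expr.bdryAux, bdryAux_update]; exact .comp_smul_right _ _ _ _ _ _
  | unit_comp f x => exact .unit_comp _ _
  | comp_unit f x => exact .comp_unit _ _
  | comp_assoc f g h e he x y z => exact .comp_assoc f g h e he _ _ _
  | idn_add a b => exact .refl _
  | idn_smul r a => exact .refl _
  | idn_unit n => exact .refl _
  | idn_comp f x y => exact .refl _
  | @exchange k l h q N m f x x' y y' hx hy _ _ =>
    obtain ⟨l, rfl⟩ := Nat.exists_eq_succ_of_ne_zero (Nat.ne_zero_of_lt h)
    change X.RespectsBelow l at hn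
    change X.Rel (.comp f (Expr.bdry d (Expr.star X.tgt h.le x x'))
      (fun i => Expr.bdry d (Expr.star X.tgt h.le (y i) (y' i))))
      (Expr.bdry d (Expr.star X.tgt h.le (.comp f x y) (.comp f x' y')))
    rcases Nat.lt_succ_iff_lt_or_eq.1 h with hkl | rfl
    · refine .trans (.comp_congr f (X.bdry_star hd hkl hn x x')
        (fun i => X.bdry_star hd hkl hn (y i) (y' i))) (.trans (.exchange hkl f ?_ fun i => ?_)
        (.symm (X.bdry_star hd hkl hn _ _)))
      · exact .trans (X.tgtTo_bdry hd hkl hn x) (.trans hx (.symm (X.srcTo_bdry hd hkl hn x')))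
      · exact .trans (X.tgtTo_bdry hd hkl hn _)
          (.trans (hy i) (.symm (X.srcTo_bdry hd hkl hn _)))
    · rw [X.bdryTo_succ _ le_rfl, X.bdryTo_succ _ le_rfl, X.bdryTo_self, X.bdryTo_self,
        ← X.cls_eq] at hx
      have hy' : ∀ i, X.cls (Expr.bdry X.tgt (y i)) = X.cls (Expr.bdry X.src (y' i)) := by
        intro i
        have := hy i
        rwa [X.bdryTo_succ _ le_rfl, X.bdryTo_succ _ le_rfl, X.bdryTo_self, X.bdryTo_self,
          ← X.cls_eq] at this
      rw [← X.cls_eq, X.cls_comp]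
      simp only [bdry_star_top]
      have hc : ∀ (d' : ∀ n k, X.gen (n + 1) k → Expr K X.gen n k) (x : Expr K X.gen (k + 1) q)
          (y : ∀ i, Expr K X.gen (k + 1) (m i)), X.cls (Expr.bdry d' (.comp f x y)) =
          (X.cell k).comp f (X.cls (Expr.bdry d' x)) (fun i => X.cls (Expr.bdry d' (y i))) :=
        fun d' x y => X.cls_comp f _ _
      simp only [hc]
      rcases hd with rfl | rfl
      · simp only [hx, hy', sub_add_cancel]
      · simp only [sub_self, zero_add]

theorem respects (n : ℕ) : X.Respects X.src n ∧ X.Respects X.tgt n := by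
  induction n using Nat.strong_induction_on with
  | _ n ih => exact ⟨fun h => X.bdryAux_congr (.inl rfl) h ih,
      fun h => X.bdryAux_congr (.inr rfl) h ih⟩

/-- The source (or target) of cells, induced by the boundary map on expressions. -/
noncomputable def bdryHom (d : ∀ n k, X.gen (n + 1) k → Expr K X.gen n k) (n : ℕ)
    (hd : X.Respects d n) : ShuffleOperad.Hom (X.cell (n + 1)) (X.cell n) where
  toFun k :=
    { toFun := Quotient.map (Expr.bdry d) (fun _ _ h => hd h)
      map_add' := fun a b => by
        induction a using X.cls_ind; induction b using X.cls_ind; rfl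
      map_smul' := fun r a => by
        induction a using X.cls_ind; rfl }
  map_unit := rfl
  map_comp f x y := by
    induction x using X.cls_ind; induction y using X.cls_ind_pi
    rw [← X.cls_comp]
    exact X.cls_comp f _ _

/-- Identities on cells. -/
noncomputable def idnHom (n : ℕ) : ShuffleOperad.Hom (X.cell n) (X.cell (n + 1)) where
  toFun k :=
    { toFun := Quotient.map Expr.idn (fun _ _ h => .idn_congr h)
      map_add' := fun a b => by
        induction a using X.cls_ind; induction b using X.cls_ind
        exact X.cls_eq.2 (.idn_add _ _)
      map_smul' := fun r a => by
        induction a using X.cls_ind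
        exact X.cls_eq.2 (.idn_smul _ _) }
  map_unit := X.cls_eq.2 (.idn_unit _)
  map_comp f x y := by
    induction x using X.cls_ind; induction y using X.cls_ind_pi
    rw [← X.cls_comp]
    exact (X.cls_eq.2 (.idn_comp f _ _)).trans (X.cls_comp f _ _)

/-- The reflexive globular operad of cells. -/
noncomputable abbrev glob : GlobOperad.{u, max u v} K where
  cell := X.cell
  src n := X.bdryHom X.src n (X.respects n).1
  tgt n := X.bdryHom X.tgt n (X.respects n).2
  idn := X.idnHom
  src_src n p a := by
    induction a using X.cls_ind; exact X.cls_eq.2 (X.rel_src_src _)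
  tgt_tgt n p a := by
    induction a using X.cls_ind; exact X.cls_eq.2 (.symm (X.rel_tgt_tgt _))
  src_idn n p a := by
    induction a using X.cls_ind; rfl
  tgt_idn n p a := by
    induction a using X.cls_ind; rfl

theorem glob_srcTo {k l : ℕ} (h : k ≤ l) {p : ℕ+} (a : Expr K X.gen l p) :
    X.glob.srcTo h (X.cls a) = X.cls (Expr.bdryTo X.src h a) := by
  induction l, h using Nat.le_induction with
  | base => rw [GlobOperad.srcTo_self, bdryTo_self]
  | succ l h ih => rw [GlobOperad.srcTo_succ _ h, X.bdryTo_succ _ h]; exact ih _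

theorem glob_tgtTo {k l : ℕ} (h : k ≤ l) {p : ℕ+} (a : Expr K X.gen l p) :
    X.glob.tgtTo h (X.cls a) = X.cls (Expr.bdryTo X.tgt h a) := by
  induction l, h using Nat.le_induction with
  | base => rw [GlobOperad.tgtTo_self, bdryTo_self]
  | succ l h ih => rw [GlobOperad.tgtTo_succ _ h, X.bdryTo_succ _ h]; exact ih _

theorem glob_idTo {k l : ℕ} (h : k ≤ l) {p : ℕ+} (a : Expr K X.gen k p) :
    X.glob.idTo h (X.cls a) = X.cls (Expr.idTo h a) := by
  induction l, h using Nat.le_induction with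
  | base => rw [GlobOperad.idTo_self, idTo_self]
  | succ l h ih => rw [GlobOperad.idTo_succ _ h, X.idTo_succ h, ih]; rfl

theorem glob_star {k l : ℕ} (h : k ≤ l) {p : ℕ+} (a b : Expr K X.gen l p) :
    X.cls a - X.glob.idTo h (X.glob.tgtTo h (X.cls a)) + X.cls b =
      X.cls (Expr.star X.tgt h a b) := by
  rw [X.cls_star, X.glob_tgtTo, X.glob_idTo]

theorem glob_exchange : X.glob.Exchange := by
  intro k l h q n m f x x' y y' hx hy
  induction x using X.cls_ind with | _ x
  induction x' using X.cls_ind with | _ x'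
  induction y using X.cls_ind_pi with | _ y
  induction y' using X.cls_ind_pi with | _ y'
  simp only [glob_srcTo, glob_tgtTo] at hx hy
  refine (congrArg₂ ((X.cell l).comp f) (X.glob_star h.le x x')
    (funext fun i => X.glob_star h.le (y i) (y' i))).trans ?_
  rw [← X.cls_comp]
  refine (X.cls_eq.2 (.exchange h f (X.cls_eq.1 hx) (fun i => X.cls_eq.1 (hy i)))).trans ?_
  rw [← X.glob_star, X.cls_comp, X.cls_comp]

/-- The free shuffle `ω`-operad on the polygraph `X`. -/
noncomputable abbrev free : OmegaOperad.{u, max u v} K := X.glob.toOmegaOperad X.glob_exchange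

/-- The shuffle operad presented by `X`: the coequalizer of `s, t : X*_1 ⇉ X*_0`. -/
noncomputable def presented : ShuffleOperad.{u, max u v} K :=
  coequalizer (X.free.src 0) (X.free.tgt 0)

/-- `X` is acyclic: for `n ≥ 1`, every pair of parallel `n`-cells of the free `ω`-operad is the
boundary of an `(n+1)`-cell. -/
def IsAcyclic : Prop :=
  ∀ (n : ℕ) (p : ℕ+) (a b : X.free.C (n + 1) p), X.free.Parallel a b →
    ∃ f : X.free.C (n + 2) p, X.free.IsCell f a b

/-- `X` and `Y` are Tietze equivalent: there is a weak equivalence between the free `ω`-operads. -/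
def TietzeEquivalent (X : OmegaPolygraph.{u, v} K) (Y : OmegaPolygraph.{u, w} K) : Prop :=
  ∃ F : OmegaOperad.Hom X.free Y.free, F.IsWeakEquivalence

end OmegaPolygraph

end ShuffleOp

/-! The operad presented by `X` is the quotient of the `0`-cells by the congruence generated by
`s(f) ~ t(f)`. Linearity makes this congruence explicit: the `1`-cells are closed under linear
combinations and operadic composition, have identities, compose by `f - t(f) + g` and are inverted
by `s(f) - f + t(f)`. Hence two `0`-cells have the same class exactly when a `1`-cell joins them
(`coeqRel_iff`, `presentedProj_eq`).

A weak equivalence therefore induces an isomorphism of presented operads: it descends to classes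
because it maps `1`-cells to `1`-cells, it is surjective by the lifting condition on `0`-cells, and
injective by the lifting condition on `1`-cells.

Conversely, an isomorphism `φ` of presented operads is realised by a morphism `F` of free
`ω`-operads, built on generators dimension by dimension. A `0`-generator goes to a representative of
the image of its class under `φ`. The source and target of a `1`-generator then go to `0`-cells of
the same class, which a `1`-cell joins. In higher dimensions the images of the source and target of
a generator are parallel by the globular relations, and acyclicity of `Y` fills them
(`liftsAt_liftAll`). Such an `F` is a weak equivalence: the bijectivity of `φ` handles the `0`-cells
and the existence of lifted `1`-cells, acyclicity of `X` produces the lifts of higher cells, and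
acyclicity of `Y` compares the image of a lift with the given cell, to which it is parallel.

Cells are expressions modulo `Rel`, so a morphism is a substitution that respects `Rel`
(`subst_rel`). The exchange relation has hypotheses on boundaries; a substitution respects `Rel` in
dimension `n` once it is compatible with the boundaries of generators of dimension at most `n`. This
is what makes the induction on dimension well founded. -/

namespace ShuffleOp

/-! ### Morphisms of shuffle operads -/

namespace ShuffleOperad

variable {K : Type u} [Field K]

/-- A morphism that is bijective in every arity is an isomorphism. -/
theorem Hom.isomorphic_of_bijective {P : ShuffleOperad.{u, v} K} {Q : ShuffleOperad.{u, w} K}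
    (F : Hom P Q) (hF : ∀ k, Function.Bijective (F.toFun k)) : P.Isomorphic Q := by
  let e : ∀ k, P.obj k ≃ₗ[K] Q.obj k := fun k => LinearEquiv.ofBijective (F.toFun k) (hF k)
  have he : ∀ k x, F.toFun k ((e k).symm x) = x := fun k x => (e k).apply_symm_apply x
  refine ⟨F, ⟨fun k => (e k).symm.toLinearMap, ?_, fun f x y => ?_⟩,
    fun k x => (e k).symm_apply_apply x, he⟩
  -- The inverse preserves the structure because `F` does and is injective: both sides are compared
  -- after applying `F`.
  · exact (hF 1).1 ((he _ _).trans F.map_unit.symm)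
  · refine (hF _).1 ((he _ _).trans ?_)
    rw [F.map_comp]
    exact congrArg₂ (Q.comp f) (he _ _).symm (funext fun i => (he _ _).symm)

/-- Composition of morphisms of shuffle operads. -/
def Hom.trans {P : ShuffleOperad.{u, v} K} {Q : ShuffleOperad.{u, w} K}
    {R : ShuffleOperad.{u, w} K} (F : Hom P Q) (G : Hom Q R) : Hom P R where
  toFun k := (G.toFun k).comp (F.toFun k)
  map_unit := by simp [F.map_unit, G.map_unit]
  map_comp f x y := by simp [F.map_comp, G.map_comp]

end ShuffleOperad

/-! ### Universal property of the coequalizer -/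

section Coequalizer

variable {K : Type u} [Field K] {P : ShuffleOperad.{u, v} K} {Q : ShuffleOperad.{u, v} K}
  (F G : ShuffleOperad.Hom P Q)

/-- The congruence `CoeqRel F G` as a setoid. -/
def CoeqRel.setoid (k : ℕ+) : Setoid (Q.obj k) where
  r := CoeqRel F G
  iseqv := ⟨.refl, .symm, .trans⟩

/-- The projection onto the coequalizer. -/
noncomputable def coequalizer.proj : ShuffleOperad.Hom Q (coequalizer F G) where
  toFun k :=
    { toFun := fun a => Quotient.mk (CoeqRel.setoid F G k) a
      map_add' := fun _ _ => rfl
      map_smul' := fun _ _ => rfl }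
  map_unit := rfl
  map_comp f x y :=
    -- Composition in the quotient is computed on the representatives `Quotient.out`, which are
    -- related to `x` and `y i` but need not equal them.
    Quotient.sound (s := CoeqRel.setoid F G _) (.comp f
      (.symm (Quotient.mk_out (s := CoeqRel.setoid F G _) x))
      (fun i => .symm (Quotient.mk_out (s := CoeqRel.setoid F G _) (y i))))

theorem coequalizer.proj_surjective (k : ℕ+) :
    Function.Surjective ((coequalizer.proj F G).toFun k) :=
  Quotient.mk_surjective (s := CoeqRel.setoid F G k)

theorem coequalizer.proj_eq {k : ℕ+} {a b : Q.obj k} :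
    (coequalizer.proj F G).toFun k a = (coequalizer.proj F G).toFun k b ↔ CoeqRel F G a b :=
  Quotient.eq (r := CoeqRel.setoid F G k)

variable {F G}

/-- A morphism that coequalizes `F` and `G` identifies related elements. -/
theorem CoeqRel.map_eq {R : ShuffleOperad.{u, w} K} (H : ShuffleOperad.Hom Q R)
    (hH : ∀ k (a : P.obj k), H.toFun k (F.toFun k a) = H.toFun k (G.toFun k a)) {k : ℕ+}
    {a b : Q.obj k} (h : CoeqRel F G a b) : H.toFun k a = H.toFun k b := by
  induction h with
  | of a => exact hH _ a
  | refl a => rfl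
  | symm _ ih => exact ih.symm
  | trans _ _ ih ih' => exact ih.trans ih'
  | add _ _ ih ih' => rw [map_add, map_add, ih, ih']
  | smul r _ ih => rw [map_smul, map_smul, ih]
  | comp f _ _ ih ih' => simp only [H.map_comp, ih, ih']

/-- The universal property of the coequalizer. -/
noncomputable def coequalizer.desc {R : ShuffleOperad.{u, w} K} (H : ShuffleOperad.Hom Q R)
    (hH : ∀ k (a : P.obj k), H.toFun k (F.toFun k a) = H.toFun k (G.toFun k a)) :
    ShuffleOperad.Hom (coequalizer F G) R where
  toFun k :=
    { toFun := Quotient.lift (s := CoeqRel.setoid F G k) (H.toFun k) (fun _ _ h => CoeqRel.map_eq H hH h)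
      map_add' := fun a b => by
        obtain ⟨a, rfl⟩ := coequalizer.proj_surjective F G k a
        obtain ⟨b, rfl⟩ := coequalizer.proj_surjective F G k b
        exact map_add (H.toFun k) a b
      map_smul' := fun r a => by
        obtain ⟨a, rfl⟩ := coequalizer.proj_surjective F G k a
        exact map_smul (H.toFun k) r a }
  map_unit := H.map_unit
  map_comp {k n m} f x y := by
    obtain ⟨x, rfl⟩ := coequalizer.proj_surjective F G k x
    choose z hz using fun i => coequalizer.proj_surjective F G (m i) (y i)
    obtain rfl : (fun i => (coequalizer.proj F G).toFun (m i) (z i)) = y := funext hz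
    rw [← (coequalizer.proj F G).map_comp]
    exact H.map_comp f x z

end Coequalizer

/-! ### The presenting congruence in terms of 1-cells -/

namespace OmegaOperad

variable {K : Type u} [Field K]

/-- The congruence that presents the coequalizer of `s, t : P_1 ⇉ P_0` is the existence of a
`1`-cell. -/
theorem coeqRel_iff (P : OmegaOperad.{u, v} K) {p : ℕ+} {a b : P.C 0 p} :
    CoeqRel (P.src 0) (P.tgt 0) a b ↔ P.OmegaEquiv a b := by
  constructor
  · intro h
    induction h with
    | of a => exact ⟨a, rfl, rfl⟩
    | refl a => exact ⟨(P.idn 0).toFun _ a, P.src_idn _ _ _, P.tgt_idn _ _ _⟩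
    | @symm k a b _ ih =>
      obtain ⟨f, rfl, rfl⟩ := ih
      -- The inverse of `f`, available because cells can be subtracted: its source is `s - s + t =
      -- t` and its target is `s - t + t = s`.
      refine ⟨(P.idn 0).toFun _ ((P.src 0).toFun _ f) - f + (P.idn 0).toFun _ ((P.tgt 0).toFun _ f),
        ?_, ?_⟩
      · rw [map_add, map_sub, P.src_idn, P.src_idn, sub_self, zero_add]
      · rw [map_add, map_sub, P.tgt_idn, P.tgt_idn, sub_add_cancel]
    | trans _ _ ih ih' =>
      obtain ⟨f, rfl, rfl⟩ := ih
      obtain ⟨g, hg, rfl⟩ := ih'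
      -- The linear form of `f ⋆_0 g`, as in `star_eq`.
      refine ⟨f - (P.idn 0).toFun _ ((P.tgt 0).toFun _ f) + g, ?_, ?_⟩
      · rw [map_add, map_sub, P.src_idn, hg, sub_add_cancel]
      · rw [map_add, map_sub, P.tgt_idn, sub_self, zero_add]
    | add _ _ ih ih' =>
      obtain ⟨f, rfl, rfl⟩ := ih
      obtain ⟨g, rfl, rfl⟩ := ih'
      exact ⟨f + g, map_add _ _ _, map_add _ _ _⟩
    | smul r _ ih =>
      obtain ⟨f, rfl, rfl⟩ := ih
      exact ⟨r • f, map_smul _ _ _, map_smul _ _ _⟩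
    | @comp k n m f x x' y y' _ _ ih ih' =>
      obtain ⟨g, rfl, rfl⟩ := ih
      choose e he he' using ih'
      obtain rfl := funext he
      obtain rfl := funext he'
      exact ⟨(P.cell 1).comp f g e, (P.src 0).map_comp _ _ _, (P.tgt 0).map_comp _ _ _⟩
  · rintro ⟨f, rfl, rfl⟩
    exact .of f

/-- A morphism of `ω`-operads maps cells to cells. -/
theorem Hom.map_isCell {P : OmegaOperad.{u, v} K} {Q : OmegaOperad.{u, w} K} (F : Hom P Q) {n : ℕ}
    {p : ℕ+} {f : P.C (n + 1) p} {a b : P.C n p} (h : P.IsCell f a b) :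
    Q.IsCell ((F.toHom (n + 1)).toFun p f) ((F.toHom n).toFun p a) ((F.toHom n).toFun p b) := by
  obtain ⟨rfl, rfl⟩ := h
  exact ⟨(F.map_src _ _ _).symm, (F.map_tgt _ _ _).symm⟩

theorem IsCell.parallel {P : OmegaOperad.{u, v} K} {n : ℕ} {p : ℕ+} {f g : P.C (n + 1) p}
    {a b : P.C n p} (hf : P.IsCell f a b) (hg : P.IsCell g a b) : P.Parallel f g :=
  ⟨hf.1.trans hg.1.symm, hf.2.trans hg.2.symm⟩

end OmegaOperad

/-! ### Substitution in expressions -/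

namespace Expr

variable {K : Type u} {A : ℕ → ℕ+ → Type v} {B : ℕ → ℕ+ → Type w}

/-- Substitution of expressions for generators. -/
def subst (σ : ∀ n k, A n k → Expr K B n k) : ∀ {n : ℕ} {k : ℕ+}, Expr K A n k → Expr K B n k
  | _, _, gen x => σ _ _ x
  | _, _, unit _ => unit _
  | _, _, idn a => idn (subst σ a)
  | _, _, zero _ _ => zero _ _
  | _, _, add a b => add (subst σ a) (subst σ b)
  | _, _, smul r a => smul r (subst σ a)
  | _, _, comp f x y => comp f (subst σ x) (fun i => subst σ (y i))

/-- Expressions of dimension `n` only involve generators of dimension at most `n`. -/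
theorem subst_congr {σ τ : ∀ n k, A n k → Expr K B n k} {n : ℕ} {k : ℕ+} (a : Expr K A n k)
    (h : ∀ j ≤ n, σ j = τ j) : subst σ a = subst τ a := by
  induction a with
  | gen x => simp only [subst, h _ le_rfl]
  | unit | zero => rfl
  | idn a ih => simp only [subst, ih fun j hj => h j (hj.trans (Nat.le_succ _))]
  | add a b iha ihb => simp only [subst, iha h, ihb h]
  | smul r a ih => simp only [subst, ih h]
  | comp f x y ihx ihy => simp only [subst, ihx h, ihy _ h]

theorem subst_idTo (σ : ∀ n k, A n k → Expr K B n k) {k l : ℕ} (h : k ≤ l) {p : ℕ+}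
    (a : Expr K A k p) : subst σ (idTo h a : Expr K A l p) = idTo h (subst σ a) := by
  induction l, h using Nat.le_induction with
  | base =>
    exact (congrArg (subst σ) (ascend_self (A := fun n => Expr K A n p) _ _ a)).trans
      (ascend_self (A := fun n => Expr K B n p) _ _ _).symm
  | succ l h ih =>
    refine (congrArg (subst σ) (ascend_succ (A := fun n => Expr K A n p) _ h _ a)).trans
      (.trans ?_ (ascend_succ (A := fun n => Expr K B n p) _ h _ _).symm)
    exact congrArg idn ih

/-- Needed because linearity of composition in its right arguments is expressed through
`Function.update`. -/
theorem subst_update (σ : ∀ n k, A n k → Expr K B n k) {n : ℕ} {k : ℕ+} {m : Fin k → ℕ+}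
    (y : ∀ i, Expr K A n (m i)) (i : Fin k) (a : Expr K A n (m i)) :
    (fun j => subst σ (Function.update y i a j)) =
      Function.update (fun j => subst σ (y j)) i (subst σ a) := by
  funext j
  by_cases h : j = i
  · subst h; simp
  · simp [Function.update_of_ne h]

end Expr

/-! ### Presented operads and weak equivalences -/

namespace OmegaPolygraph

variable {K : Type u} [Field K] (X : OmegaPolygraph.{u, v} K) (Y : OmegaPolygraph.{u, w} K)

/-- The projection of `0`-cells onto the presented operad. -/
noncomputable def presentedProj : ShuffleOperad.Hom (X.cell 0) X.presented :=
  coequalizer.proj (X.free.src 0) (X.free.tgt 0)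

theorem presentedProj_surjective (p : ℕ+) : Function.Surjective (X.presentedProj.toFun p) :=
  coequalizer.proj_surjective (X.free.src 0) (X.free.tgt 0) p

theorem presentedProj_eq {p : ℕ+} {a b : X.free.C 0 p} :
    X.presentedProj.toFun p a = X.presentedProj.toFun p b ↔ X.free.OmegaEquiv a b :=
  (coequalizer.proj_eq (X.free.src 0) (X.free.tgt 0)).trans X.free.coeqRel_iff

/-- A weak equivalence between free `ω`-operads induces an isomorphism of the presented operads. -/
theorem TietzeEquivalent.presented_isomorphic {X : OmegaPolygraph.{u, v} K}
    {Y : OmegaPolygraph.{u, w} K} (h : X.TietzeEquivalent Y) :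
    X.presented.Isomorphic Y.presented := by
  obtain ⟨F, hF⟩ := h
  let H : ShuffleOperad.Hom (X.cell 0) Y.presented := (F.toHom 0).trans Y.presentedProj
  have hH : ∀ k (a : (X.free.cell 1).obj k),
      H.toFun k ((X.free.src 0).toFun k a) = H.toFun k ((X.free.tgt 0).toFun k a) := fun k a =>
    Y.presentedProj_eq.2 ⟨_, F.map_isCell ⟨rfl, rfl⟩⟩
  refine ShuffleOperad.Hom.isomorphic_of_bijective
    (coequalizer.desc (F := X.free.src 0) (G := X.free.tgt 0) H hH) fun k => ⟨?_, ?_⟩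
  -- Injectivity: equal classes in `Y.presented` give a `1`-cell `F(a) → F(b)`, which lifts to a
  -- `1`-cell `a → b`.
  · intro a b hab
    obtain ⟨a, rfl⟩ := X.presentedProj_surjective k a
    obtain ⟨b, rfl⟩ := X.presentedProj_surjective k b
    obtain ⟨f, hf⟩ := Y.presentedProj_eq.1 hab
    obtain ⟨f', hf', -⟩ := hF.lift_one k a b f hf
    exact X.presentedProj_eq.2 ⟨f', hf'⟩
  -- Surjectivity is the lifting condition on `0`-cells.
  · intro b
    obtain ⟨b, rfl⟩ := Y.presentedProj_surjective k b
    obtain ⟨a, ha⟩ := hF.surj k b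
    exact ⟨X.presentedProj.toFun k a, Y.presentedProj_eq.2 ha⟩

/-! ### Morphisms of free ω-operads from substitutions -/

section Substitution

variable {X Y} (σ : ∀ n k, X.gen n k → Expr K Y.gen n k)

/-- The substitution `σ` is compatible with the boundaries of the `(n+1)`-generator `x` when it maps
`x` to `e`. -/
def IsLift {n : ℕ} {k : ℕ+} (x : X.gen (n + 1) k) (e : Expr K Y.gen (n + 1) k) : Prop :=
  Y.Rel (Expr.bdry Y.src e) (Expr.subst σ (X.src n k x)) ∧
    Y.Rel (Expr.bdry Y.tgt e) (Expr.subst σ (X.tgt n k x))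

/-- The substitution `σ` is compatible with the boundaries of all `(n+1)`-generators. -/
def LiftsAt (n : ℕ) : Prop := ∀ k (x : X.gen (n + 1) k), IsLift σ x (σ _ _ x)

variable {σ}

/-- Boundaries and substitutions are both defined by structural recursion, so only generators need
checking. The dimension is a variable `n ≠ 0`, not a successor, so that induction on the indexed
type `Expr` applies; sources and targets are treated at once. -/
theorem bdryAux_subst {dX : ∀ n k, X.gen (n + 1) k → Expr K X.gen n k}
    {dY : ∀ n k, Y.gen (n + 1) k → Expr K Y.gen n k} {n : ℕ} {k : ℕ+} (a : Expr K X.gen n k)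
    (hn : n ≠ 0) (hd : ∀ j, j + 1 = n → ∀ k (x : X.gen (j + 1) k),
      Y.Rel (Expr.bdry dY (σ _ _ x)) (Expr.subst σ (dX j k x))) :
    Y.Rel (Expr.bdryAux dY (Expr.subst σ a)) (Expr.subst σ (Expr.bdryAux dX a)) := by
  induction a with
  | @gen n k x =>
    obtain ⟨n, rfl⟩ := Nat.exists_eq_succ_of_ne_zero hn
    exact hd n rfl k x
  | unit | idn | zero => exact .refl _
  | add a b iha ihb => exact .add_congr (iha hn hd) (ihb hn hd)
  | smul r a ih => exact .smul_congr r (ih hn hd)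
  | comp f x y ihx ihy => exact .comp_congr f (ihx hn hd) (fun i => ihy i hn hd)

theorem bdry_src_subst {n : ℕ} (h : LiftsAt σ n) {k : ℕ+} (a : Expr K X.gen (n + 1) k) :
    Y.Rel (Expr.bdry Y.src (Expr.subst σ a)) (Expr.subst σ (Expr.bdry X.src a)) :=
  bdryAux_subst a n.succ_ne_zero fun j hj k x => by
    obtain rfl := Nat.succ_injective hj; exact (h k x).1

theorem bdry_tgt_subst {n : ℕ} (h : LiftsAt σ n) {k : ℕ+} (a : Expr K X.gen (n + 1) k) :
    Y.Rel (Expr.bdry Y.tgt (Expr.subst σ a)) (Expr.subst σ (Expr.bdry X.tgt a)) :=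
  bdryAux_subst a n.succ_ne_zero fun j hj k x => by
    obtain rfl := Nat.succ_injective hj; exact (h k x).2

theorem bdryTo_src_subst {k l : ℕ} (hkl : k ≤ l) (h : ∀ j < l, LiftsAt σ j) {p : ℕ+}
    (a : Expr K X.gen l p) :
    Y.Rel (Expr.bdryTo Y.src hkl (Expr.subst σ a)) (Expr.subst σ (Expr.bdryTo X.src hkl a)) := by
  induction l, hkl using Nat.le_induction with
  | base => rw [Y.bdryTo_self, X.bdryTo_self]; exact .refl _
  | succ l hkl ih =>
    rw [Y.bdryTo_succ _ hkl, X.bdryTo_succ _ hkl]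
    exact .trans (Y.bdryTo_congr hkl (fun j _ => (Y.respects j).1)
      (bdry_src_subst (h l l.lt_succ_self) a)) (ih (fun j hj => h j (hj.trans l.lt_succ_self)) _)

theorem bdryTo_tgt_subst {k l : ℕ} (hkl : k ≤ l) (h : ∀ j < l, LiftsAt σ j) {p : ℕ+}
    (a : Expr K X.gen l p) :
    Y.Rel (Expr.bdryTo Y.tgt hkl (Expr.subst σ a)) (Expr.subst σ (Expr.bdryTo X.tgt hkl a)) := by
  induction l, hkl using Nat.le_induction with
  | base => rw [Y.bdryTo_self, X.bdryTo_self]; exact .refl _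
  | succ l hkl ih =>
    rw [Y.bdryTo_succ _ hkl, X.bdryTo_succ _ hkl]
    exact .trans (Y.bdryTo_congr hkl (fun j _ => (Y.respects j).2)
      (bdry_tgt_subst (h l l.lt_succ_self) a)) (ih (fun j hj => h j (hj.trans l.lt_succ_self)) _)

/-- In `a - t_k(a) + b` only the term `t_k(a)` is not preserved on the nose; it is preserved up to
`Rel` by compatibility with targets. -/
theorem subst_star {k l : ℕ} (hkl : k ≤ l) (h : ∀ j < l, LiftsAt σ j) {p : ℕ+}
    (a b : Expr K X.gen l p) :
    Y.Rel (Expr.subst σ (Expr.star X.tgt hkl a b))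
      (Expr.star Y.tgt hkl (Expr.subst σ a) (Expr.subst σ b)) := by
  refine .add_congr (.add_congr (.refl _) (.smul_congr _ ?_)) (.refl _)
  rw [Expr.subst_idTo]
  exact Y.idTo_congr hkl (.symm (bdryTo_tgt_subst hkl h a))

/-- A substitution compatible with boundaries respects equality of expressions. -/
theorem subst_rel {n : ℕ} {k : ℕ+} {a b : Expr K X.gen n k} (hab : X.Rel a b)
    (hn : ∀ j < n, LiftsAt σ j) : Y.Rel (Expr.subst σ a) (Expr.subst σ b) := by
  induction hab with
  | refl a => exact .refl _
  | symm _ ih => exact .symm (ih hn)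
  | trans _ _ ih ih' => exact .trans (ih hn) (ih' hn)
  | add_congr _ _ ih ih' => exact .add_congr (ih hn) (ih' hn)
  | smul_congr r _ ih => exact .smul_congr r (ih hn)
  | comp_congr f _ _ ih ih' => exact .comp_congr f (ih hn) (fun i => ih' i hn)
  | idn_congr _ ih => exact .idn_congr (ih fun j hj => hn j (hj.trans (Nat.lt_succ_self _)))
  | add_assoc a b c => exact .add_assoc _ _ _
  | add_comm a b => exact .add_comm _ _
  | add_zero a => exact .add_zero _
  | add_neg a => exact .add_neg _
  | smul_add r a b => exact .smul_add _ _ _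
  | add_smul r s a => exact .add_smul _ _ _
  | mul_smul r s a => exact .mul_smul _ _ _
  | one_smul a => exact .one_smul _
  | comp_add_left f x x' y => exact .comp_add_left _ _ _ _
  | comp_smul_left f r x y => exact .comp_smul_left _ _ _ _
  | comp_add_right f x y i a b =>
    simp only [Expr.subst, Expr.subst_update]; exact .comp_add_right _ _ _ _ _ _
  | comp_smul_right f x y i r a =>
    simp only [Expr.subst, Expr.subst_update]; exact .comp_smul_right _ _ _ _ _ _
  | unit_comp f x => exact .unit_comp _ _
  | comp_unit f x => exact .comp_unit _ _
  | comp_assoc f g h e he x y z => exact .comp_assoc f g h e he _ _ _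
  | idn_add a b => exact .idn_add _ _
  | idn_smul r a => exact .idn_smul _ _
  | idn_unit n => exact .idn_unit _
  | idn_comp f x y => exact .idn_comp _ _ _
  -- The one case that needs `LiftsAt`. The induction hypotheses relate the substituted
  -- `k`-boundaries; commuting boundaries with `σ` turns this into composability of the substituted
  -- expressions, as exchange in `Y` requires.
  | @exchange k l h q N m f x x' y y' _ _ ihx ihy =>
    have hk : ∀ j < k, LiftsAt σ j := fun j hj => hn j (hj.trans h)
    refine .trans (.comp_congr f (subst_star h.le hn x x')
      (fun i => subst_star h.le hn (y i) (y' i))) (.trans (.exchange h f ?_ fun i => ?_)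
      (.symm (subst_star h.le hn _ _)))
    · exact .trans (bdryTo_tgt_subst h.le hn x)
        (.trans (ihx hk) (.symm (bdryTo_src_subst h.le hn x')))
    · exact .trans (bdryTo_tgt_subst h.le hn _)
        (.trans (ihy i hk) (.symm (bdryTo_src_subst h.le hn _)))

/-- The morphism of operads of `n`-cells induced by a substitution. -/
noncomputable def substHom (h : ∀ j, LiftsAt σ j) (n : ℕ) :
    ShuffleOperad.Hom (X.cell n) (Y.cell n) where
  toFun k :=
    { toFun := Quotient.map (Expr.subst σ) (fun _ _ hab => subst_rel hab fun j _ => h j)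
      map_add' := fun a b => by
        induction a using X.cls_ind; induction b using X.cls_ind; rfl
      map_smul' := fun r a => by
        induction a using X.cls_ind; rfl }
  map_unit := rfl
  map_comp f x y := by
    induction x using X.cls_ind; induction y using X.cls_ind_pi
    rw [← X.cls_comp]
    exact Y.cls_comp f _ _

theorem substHom_idTo (h : ∀ j, LiftsAt σ j) {k l : ℕ} (hkl : k ≤ l) {p : ℕ+} (a : X.free.C k p) :
    (substHom h l).toFun p (X.free.idTo hkl a) =
      Y.free.idTo hkl ((substHom h k).toFun p a) := by
  induction a using X.cls_ind with | _ a
  rw [X.glob_idTo]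
  refine .trans ?_ (Y.glob_idTo hkl _).symm
  exact congrArg Y.cls (Expr.subst_idTo σ hkl a)

theorem substHom_tgtTo (h : ∀ j, LiftsAt σ j) {k l : ℕ} (hkl : k ≤ l) {p : ℕ+} (a : X.free.C l p) :
    (substHom h k).toFun p (X.free.tgtTo hkl a) =
      Y.free.tgtTo hkl ((substHom h l).toFun p a) := by
  induction a using X.cls_ind with | _ a
  rw [X.glob_tgtTo]
  refine .trans ?_ (Y.glob_tgtTo hkl _).symm
  exact Y.cls_eq.2 (.symm (bdryTo_tgt_subst hkl (fun j _ => h j) a))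

/-- The morphism of free `ω`-operads induced by a substitution. -/
noncomputable def substOmegaHom (h : ∀ j, LiftsAt σ j) : OmegaOperad.Hom X.free Y.free where
  toHom := substHom h
  map_src n p a := by
    induction a using X.cls_ind with | _ a
    exact Y.cls_eq.2 (.symm (bdry_src_subst (h n) a))
  map_tgt n p a := by
    induction a using X.cls_ind with | _ a
    exact Y.cls_eq.2 (.symm (bdry_tgt_subst (h n) a))
  map_idn n p a := by
    induction a using X.cls_ind; rfl
  map_star {k l} hkl p a b _ _ := by
    -- In the free `ω`-operads `⋆_k` is by definition `a - t_k(a) + b`, so linearity leaves only the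
    -- middle term.
    refine (map_add _ _ _).trans (congrArg₂ (· + ·) ((map_sub _ _ _).trans ?_) rfl)
    rw [substHom_idTo, substHom_tgtTo]

end Substitution

/-! ### Inductive construction of a lift -/

section Construction

variable {X Y}

open Classical in
/-- Change a substitution in dimension `n + 1`, choosing there cells with the required boundaries
whenever they exist. -/
noncomputable def extendLift (σ : ∀ n k, X.gen n k → Expr K Y.gen n k) (n : ℕ) :
    ∀ n k, X.gen n k → Expr K Y.gen n k :=
  Function.update σ (n + 1) fun k x =>
    -- The default `zero` lets the recursion run without carrying a proof that lifts exist; under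
    -- the hypotheses of `liftsAt_liftAll` it is never taken.
    if h : ∃ e, IsLift σ x e then h.choose else .zero (n + 1) k

/-- A given substitution in dimension `0`, extended dimension by dimension up to dimension `n`. -/
noncomputable def liftUpTo (σ : ∀ n k, X.gen n k → Expr K Y.gen n k) :
    ℕ → ∀ n k, X.gen n k → Expr K Y.gen n k
  | 0 => σ
  | n + 1 => extendLift (liftUpTo σ n) n

/-- A given substitution in dimension `0`, extended to all dimensions. -/
noncomputable def liftAll (σ : ∀ n k, X.gen n k → Expr K Y.gen n k) (n : ℕ) (k : ℕ+) :
    X.gen n k → Expr K Y.gen n k := liftUpTo σ n n k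

variable (σ : ∀ n k, X.gen n k → Expr K Y.gen n k)

/-- Stage `n + 1` modifies dimension `n + 1` only, so dimension `j` is final from stage `j` on. -/
theorem liftUpTo_eq {j n : ℕ} (h : j ≤ n) : liftUpTo σ n j = liftAll σ j := by
  induction n, h using Nat.le_induction with
  | base => rfl
  | succ n h ih => exact (Function.update_of_ne (Nat.lt_succ_of_le h).ne _ _).trans ih

theorem subst_liftUpTo {n : ℕ} {k : ℕ+} (a : Expr K X.gen n k) :
    Expr.subst (liftUpTo σ n) a = Expr.subst (liftAll σ) a :=
  Expr.subst_congr a fun _ hj => liftUpTo_eq σ hj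

/-- The condition applies the substitution only to the `n`-dimensional boundaries of `x`, so a
choice made against stage `n` remains correct for the final substitution. -/
theorem isLift_liftUpTo {n : ℕ} {k : ℕ+} (x : X.gen (n + 1) k) (e : Expr K Y.gen (n + 1) k) :
    IsLift (liftUpTo σ n) x e ↔ IsLift (liftAll σ) x e := by
  unfold IsLift; rw [subst_liftUpTo, subst_liftUpTo]

theorem isLift_liftAll {n : ℕ} {k : ℕ+} (x : X.gen (n + 1) k)
    (h : ∃ e, IsLift (liftAll σ) x e) : IsLift (liftAll σ) x (liftAll σ (n + 1) k x) := by
  have h' : ∃ e, IsLift (liftUpTo σ n) x e := by simpa only [isLift_liftUpTo] using h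
  have e : liftAll σ (n + 1) k x = h'.choose := by
    change extendLift (liftUpTo σ n) n (n + 1) k x = _
    rw [extendLift, Function.update_self, dif_pos h']
  rw [e, ← isLift_liftUpTo]
  exact h'.choose_spec

/-- If `Y` is acyclic, an assignment of `0`-generators that is compatible with `1`-generators up to
`1`-cells extends to a substitution compatible with boundaries. -/
theorem liftsAt_liftAll (hY : Y.IsAcyclic)
    (h₀ : ∀ k (x : X.gen 1 k), Y.free.OmegaEquiv (Y.cls (Expr.subst σ (X.src 0 k x)))
      (Y.cls (Expr.subst σ (X.tgt 0 k x)))) (n : ℕ) : LiftsAt (liftAll σ) n := by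
  induction n using Nat.strong_induction_on with | _ n ih
  intro k x
  apply isLift_liftAll
  -- A lift of `x` is an expression for an `(n+1)`-cell joining the images of its source and target.
  suffices Y.free.OmegaEquiv (Y.cls (Expr.subst (liftAll σ) (X.src n k x)))
      (Y.cls (Expr.subst (liftAll σ) (X.tgt n k x))) by
    obtain ⟨f, hf⟩ := this
    induction f using Y.cls_ind with | _ e
    exact ⟨e, Y.cls_eq.1 hf.1, Y.cls_eq.1 hf.2⟩
  match n, ih, x with
  | 0, _, x =>
    rw [← subst_liftUpTo, ← subst_liftUpTo]
    exact h₀ k x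
  | n + 1, ih, x =>
    have hn := ih n n.lt_succ_self
    have hlt : ∀ j < n, LiftsAt (liftAll σ) j := fun j hj => ih j (hj.trans n.lt_succ_self)
    -- The two images are parallel: boundaries commute with the substitution in dimension `n + 1`,
    -- and the globular relations of `x`, which live in dimension `n`, are preserved using
    -- compatibility below `n` only.
    refine hY n k _ _ ⟨Y.cls_eq.2 ?_, Y.cls_eq.2 ?_⟩
    · exact .trans (bdry_src_subst hn _)
        (.trans (subst_rel (X.src_src n k x) hlt) (.symm (bdry_src_subst hn _)))
    · exact .trans (bdry_tgt_subst hn _)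
        (.trans (subst_rel (X.tgt_tgt n k x) hlt) (.symm (bdry_tgt_subst hn _)))

end Construction

/-! ### Lifting an isomorphism of presented operads -/

variable {X Y}

/-- Both sides respect the operadic operations, so agreement on `0`-generators suffices. The
dimension is a variable with `hn : n = 0` to allow induction on `Expr`; the equation rules out
identities. -/
theorem presentedProj_subst (φ : ShuffleOperad.Hom X.presented Y.presented)
    {σ : ∀ n k, X.gen n k → Expr K Y.gen n k}
    (hσ : ∀ k (x : X.gen 0 k), Y.presentedProj.toFun k (Y.cls (σ 0 k x)) =
      φ.toFun k (X.presentedProj.toFun k (X.cls (.gen x))))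
    {n : ℕ} {k : ℕ+} (a : Expr K X.gen n k) (hn : n = 0) :
    Y.presentedProj.toFun k (Y.cls (hn ▸ Expr.subst σ a)) =
      φ.toFun k (X.presentedProj.toFun k (X.cls (hn ▸ a))) := by
  induction a with
  | gen x => subst hn; exact hσ _ x
  | unit =>
    subst hn
    change Y.presentedProj.toFun 1 (Y.cell 0).unit =
      φ.toFun 1 (X.presentedProj.toFun 1 (X.cell 0).unit)
    rw [Y.presentedProj.map_unit, X.presentedProj.map_unit, φ.map_unit]
  | idn => exact absurd hn (Nat.succ_ne_zero _)
  | zero n k =>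
    subst hn
    change Y.presentedProj.toFun k 0 = φ.toFun k (X.presentedProj.toFun k 0)
    simp only [map_zero]
  | add a b iha ihb =>
    subst hn
    refine (map_add (Y.presentedProj.toFun _) (Y.cls (Expr.subst σ a))
      (Y.cls (Expr.subst σ b))).trans ?_
    refine (congrArg₂ (· + ·) (iha rfl) (ihb rfl)).trans ?_
    simp only [X.cls_add, map_add]
  | smul r a ih =>
    subst hn
    refine (map_smul (Y.presentedProj.toFun _) r (Y.cls (Expr.subst σ a))).trans ?_
    refine (congrArg (r • ·) (ih rfl)).trans ?_
    simp only [X.cls_smul, map_smul]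
  | comp f x y ihx ihy =>
    subst hn
    refine (congrArg _ (Y.cls_comp f _ _)).trans ((Y.presentedProj.map_comp f _ _).trans ?_)
    refine (congrArg₂ (Y.presented.comp f) (ihx rfl) (funext fun i => ihy i rfl)).trans ?_
    rw [X.cls_comp, X.presentedProj.map_comp, φ.map_comp]

/-- An isomorphism between the operads presented by acyclic polygraphs lifts to a weak equivalence
between the free `ω`-operads. -/
theorem tietzeEquivalent_of_isomorphic (hX : X.IsAcyclic) (hY : Y.IsAcyclic)
    (h : X.presented.Isomorphic Y.presented) : X.TietzeEquivalent Y := by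
  obtain ⟨φ, ψ, hψφ, hφψ⟩ := h
  have hrep : ∀ k (q : Y.presented.obj k),
      ∃ e : Expr K Y.gen 0 k, Y.presentedProj.toFun k (Y.cls e) = q := by
    intro k q
    obtain ⟨c, rfl⟩ := Y.presentedProj_surjective k q
    induction c using Y.cls_ind with | _ e
    exact ⟨e, rfl⟩
  choose rep hrep using hrep
  let σ : ∀ n k, X.gen n k → Expr K Y.gen n k
    | 0, k, x => rep k (φ.toFun k (X.presentedProj.toFun k (X.cls (.gen x))))
    | n + 1, k, _ => .zero (n + 1) k
  have hσ : ∀ {k} (a : Expr K X.gen 0 k), Y.presentedProj.toFun k (Y.cls (Expr.subst σ a)) =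
      φ.toFun k (X.presentedProj.toFun k (X.cls a)) := fun a =>
    presentedProj_subst φ (fun k x => hrep k _) a rfl
  have hL : ∀ n, LiftsAt (liftAll σ) n := liftsAt_liftAll σ hY fun k x => by
    rw [← Y.presentedProj_eq, hσ, hσ]
    -- The generator `x` is itself a `1`-cell from its source to its target, so these have the same
    -- class, and `φ` preserves this equality.
    exact congrArg _ (X.presentedProj_eq.2 ⟨X.cls (.gen x), rfl, rfl⟩)
  let F := substOmegaHom hL
  -- `F` induces `φ` on classes; in dimension `0`, `liftAll σ` is still `σ`.
  have hF : ∀ k (c : X.free.C 0 k), Y.presentedProj.toFun k ((F.toHom 0).toFun k c) =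
      φ.toFun k (X.presentedProj.toFun k c) := by
    intro k c
    induction c using X.cls_ind with | _ a
    exact (congrArg (fun e => Y.presentedProj.toFun k (Y.cls e)) (subst_liftUpTo σ a).symm).trans
      (hσ a)
  refine ⟨F, fun p a => ?_, fun p a b f hf => ?_, fun n p a b hab f hf => ?_⟩
  · obtain ⟨a', ha'⟩ := X.presentedProj_surjective p (ψ.toFun p (Y.presentedProj.toFun p a))
    exact ⟨a', Y.presentedProj_eq.1 (by rw [hF, ha', hφψ])⟩
  -- The cell `f` gives `φ[a] = φ[b]`, hence `[a] = [b]` on applying `ψ`, and a `1`-cell `f' : a →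
  -- b`. Then `F(f')` and `f` are parallel, and acyclicity of `Y` joins them.
  · have hab : X.presentedProj.toFun p a = X.presentedProj.toFun p b := by
      rw [← hψφ p (X.presentedProj.toFun p a), ← hF, Y.presentedProj_eq.2 ⟨f, hf⟩, hF, hψφ]
    obtain ⟨f', hf'⟩ := X.presentedProj_eq.1 hab
    exact ⟨f', hf', hY 0 p _ _ ((F.map_isCell hf').parallel hf)⟩
  -- Here acyclicity of `X` supplies `f'` directly from the parallelism of `a` and `b`.
  · obtain ⟨f', hf'⟩ := hX n p a b hab
    exact ⟨f', hf', hY (n + 1) p _ _ ((F.map_isCell hf').parallel hf)⟩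

end OmegaPolygraph

end ShuffleOp

theorem propositionP {K : Type u} [Field K] [CharZero K] (X : ShuffleOp.OmegaPolygraph.{u, v} K)
    (Y : ShuffleOp.OmegaPolygraph.{u, w} K) (hX : X.IsAcyclic) (hY : Y.IsAcyclic) :
    X.presented.Isomorphic Y.presented ↔ X.TietzeEquivalent Y :=
  ⟨ShuffleOp.OmegaPolygraph.tietzeEquivalent_of_isomorphic hX hY,
    fun h => h.presented_isomorphic⟩
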